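/- \textbf{Game.} Let $G$ be a finite connected graph. In round $1$ the cops are placed on vertices and then the robber is placed on a vertex; in each later round first every cop, and then the robber, stays or moves to an adjacent vertex. The robber is captured as soon as he shares a vertex with a cop. The cop number of $G$ is the least $k$ such that $k$ cops have a strategy that captures every robber. A graph is (claw, even-hole)-free if it has no induced $K_{1,3}$ and no induced cycle of even length $\ge 4$. \textbf{Levels.} For adjacent $u_0,u_1$ let $B_0=N(u_0)\setminus\{u_1\}$, let $G_0$ be the connected component of $G-B_0$ containing $u_0$, let $L_j$ be the set of vertices at distance $j$ from $u_0$ in $G_0$, and $L_{\ge j}=\bigcup_{i\ge j}L_i$. A level component in $L_j$ is a connected component of $G_0[L_j]$. For a level component $C$ in $L_j$, its mate $\eta(C)$ is the level component $C'\neq C$ in $L_j$ that is joined to $C$ by a path with all vertices in $L_{\ge j}$, if there is one, and $\eta(C)=C$ otherwise. A king vertex of $C$ is a vertex of $C$ adjacent to all other vertices of $C$. A simple path is a path of $G_0$ with at most one vertex in each level. Two sets of vertices are connected to each other if some edge joins them. \textbf{Algorithm for three cops $c_0,c_1,c_2$.} Place all three cops on a vertex $u_0$. Whenever, at the cops' turn,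 the robber is adjacent to some cop, that cop captures him. Otherwise the cops play as follows, and $c_0$ stays on $u_0$. In round $2$ let $u_1$ be the vertex after $u_0$ on a shortest path of $G$ from $u_0$ to the robber, and move $c_1,c_2$ to $u_1$. Afterwards steps of the following two kinds are carried out one after the other. At the beginning of a step let $c_1,c_2$ be on $k_1,k_2$ in the level components $C_1,C_2$ in $L_j$. Take a simple path $P$ from $u_1$ to the robber passing through a vertex $v\in C_i$, where $i\in\{1,2\}$, let $C_i^+$ be the level component in $L_{j+1}$ of the vertex following $v$ on $P$, and let $i'$ be the other index. \begin{itemize} \item Progressing, if $C_{i'}$ is connected to $\eta(C_i^+)$: choose king vertices $k_i'$ of $C_i^+$ and $k_{i'}'$ of $\eta(C_i^+)$. For each $m\in\{1,2\}$, if $k_m$ is adjacent to $k_m'$, then $c_m$ moves to $k_m'$ (and waits there if the other cop needs another round); otherwise $c_m$ moves to a vertex $v_m\in C_m$ adjacent to $k_m'$ and in the next round to $k_m'$. \item Synchronizing, if no edge joins $C_{i'}$ and $\eta(C_i^+)$: $c_i$ stays, and $c_{i'}$ moves to a king vertex of $C_i$ along a path in $L_{\ge j}$ that is shortest among all paths of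 $G_0[L_{\ge j}]$ from $c_{i'}$ to king vertices of $C_i$. \end{itemize} \textbf{Theorem.} Let $G$ be a connected (claw, even-hole)-free graph with $n$ vertices. For every starting vertex $u_0$, the algorithm can always be carried out with legal moves until the robber is captured, and it captures him within at most $n$ rounds, however its remaining free choices are made and however the robber plays. In particular, for every $u_0$, three cops starting on $u_0$ have a strategy that captures the robber within $n$ rounds, and the cop number of $G$ is at most $3$. -/

import Mathlib

namespace CopsRobber

/-! ### Claw-free and even-hole-free graphs -/

/-- No induced star with three leaves. -/
def ClawFree {V : Type*} (G : SimpleGraph V) : Prop :=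
  ¬ (completeBipartiteGraph (Fin 1) (Fin 3)).IsIndContained G

/-- No induced cycle of even length at least four. -/
def EvenHoleFree {V : Type*} (G : SimpleGraph V) : Prop :=
  ∀ k : ℕ, 4 ≤ k → Even k → ¬ (SimpleGraph.cycleGraph k).IsIndContained G

/-! ### The game of cops and robber -/

/-- A legal cops' turn: every cop stays or moves to an adjacent vertex. -/
def CopMove {V : Type*} {k : ℕ} (G : SimpleGraph V) (c c' : Fin k → V) : Prop :=
  ∀ i, c' i = c i ∨ G.Adj (c i) (c' i)

/-- A strategy for `k` cops. If `h` lists the positions that the robber has taken so far, the most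
recent one first, then `position h` gives the places of the cops after their next turn; in
particular `position []` is the initial placement. -/
structure CopStrategy {V : Type*} (G : SimpleGraph V) (k : ℕ) where
  position : List V → Fin k → V
  legal : ∀ (r : V) (h : List V), CopMove G (position h) (position (r :: h))

/-- A trajectory of the robber: `ρ t` is his position at the end of round `t + 1`. The value `ρ 0`
is his initial placement; afterwards he stays or moves to an adjacent vertex. -/
def IsRobberPlay {V : Type*} (G : SimpleGraph V) (ρ : ℕ → V) : Prop :=
  ∀ t, ρ (t + 1) = ρ t ∨ G.Adj (ρ t) (ρ (t + 1))

/-- The robber's positions in the first `t` rounds, the most recent one first. -/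
def history {V : Type*} (ρ : ℕ → V) : ℕ → List V
  | 0 => []
  | t + 1 => ρ t :: history ρ t

/-- The robber is captured in round `t + 1`: at the cops' turn of that round some cop comes to his
position (impossible in the first round, where he is not yet placed), or after the robber's turn of
that round he shares a vertex with a cop. -/
def CopStrategy.CapturesAt {V : Type*} {G : SimpleGraph V} {k : ℕ} (σ : CopStrategy G k)
    (ρ : ℕ → V) (t : ℕ) : Prop :=
  ∃ i : Fin k, (∃ s, t = s + 1 ∧ σ.position (history ρ t) i = ρ s) ∨
    σ.position (history ρ t) i = ρ t

/-- The strategy captures every robber within `T` rounds; placing the players is round one. -/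
def CopStrategy.WinsWithin {V : Type*} {G : SimpleGraph V} {k : ℕ} (σ : CopStrategy G k)
    (T : ℕ) : Prop :=
  ∀ ρ : ℕ → V, IsRobberPlay G ρ → ∃ t < T, σ.CapturesAt ρ t

/-- The strategy captures every robber. -/
def CopStrategy.Wins {V : Type*} {G : SimpleGraph V} {k : ℕ} (σ : CopStrategy G k) : Prop :=
  ∀ ρ : ℕ → V, IsRobberPlay G ρ → ∃ t, σ.CapturesAt ρ t

/-- The cop number of a connected finite graph. -/
noncomputable def copNumber {V : Type*} (G : SimpleGraph V) : ℕ :=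
  sInf {k | ∃ σ : CopStrategy G k, σ.Wins}

/-! ### Levels and level components -/

/-- `B₀ = N(u₀) \ {u₁}`. -/
def box {V : Type*} (G : SimpleGraph V) (u₀ u₁ : V) : Set V :=
  G.neighborSet u₀ \ {u₁}

/-- The graph `G - B₀`, kept on the vertex type `V` (the vertices of `B₀` become isolated). The
graph `G₀` is its connected component containing `u₀`. -/
def unboxed {V : Type*} (G : SimpleGraph V) (u₀ u₁ : V) : SimpleGraph V where
  Adj x y := G.Adj x y ∧ x ∉ box G u₀ u₁ ∧ y ∉ box G u₀ u₁
  symm := ⟨fun _ _ h => ⟨h.1.symm, h.2.2, h.2.1⟩⟩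
  loopless := ⟨fun _ h => h.1.ne rfl⟩

/-- The distance to `u₀` in `G₀`. -/
noncomputable def depth {V : Type*} (G : SimpleGraph V) (u₀ u₁ x : V) : ℕ :=
  (unboxed G u₀ u₁).dist u₀ x

/-- The level `L_i`: the vertices of `G₀` at distance `i` from `u₀` in `G₀`. -/
def level {V : Type*} (G : SimpleGraph V) (u₀ u₁ : V) (i : ℕ) : Set V :=
  {x | (unboxed G u₀ u₁).Reachable u₀ x ∧ depth G u₀ u₁ x = i}

/-- `L_{≥ i}`. -/
def levelGE {V : Type*} (G : SimpleGraph V) (u₀ u₁ : V) (i : ℕ) : Set V :=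
  {x | (unboxed G u₀ u₁).Reachable u₀ x ∧ i ≤ depth G u₀ u₁ x}

/-- The vertices that can be reached from `x` by walks all of whose vertices are in `S`. For
`x ∈ S` this is the connected component of `x` in `H[S]`. -/
def componentIn {V : Type*} (H : SimpleGraph V) (S : Set V) (x : V) : Set V :=
  {y | ∃ w : H.Walk x y, ∀ z ∈ w.support, z ∈ S}

/-- The level component that contains `x`. -/
def levelComponent {V : Type*} (G : SimpleGraph V) (u₀ u₁ x : V) : Set V :=
  componentIn (unboxed G u₀ u₁) (level G u₀ u₁ (depth G u₀ u₁ x)) x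

/-- `C` is a level component in `L_i`. -/
def IsLevelComponent {V : Type*} (G : SimpleGraph V) (u₀ u₁ : V) (i : ℕ) (C : Set V) : Prop :=
  ∃ x ∈ level G u₀ u₁ i, C = levelComponent G u₀ u₁ x

/-- There is a path from `C` to `D` whose vertices are all in `L_{≥ i}`. -/
def LinkedAbove {V : Type*} (G : SimpleGraph V) (u₀ u₁ : V) (i : ℕ) (C D : Set V) : Prop :=
  ∃ x ∈ C, ∃ y ∈ D, y ∈ componentIn (unboxed G u₀ u₁) (levelGE G u₀ u₁ i) x

/-- `D = η(C)` for a level component `C` in `L_i`: `D` is another level component in `L_i` linked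
to `C` through `L_{≥ i}`, or `D = C` when there is no such level component. -/
def IsMate {V : Type*} (G : SimpleGraph V) (u₀ u₁ : V) (i : ℕ) (C D : Set V) : Prop :=
  (IsLevelComponent G u₀ u₁ i D ∧ D ≠ C ∧ LinkedAbove G u₀ u₁ i C D) ∨
  (D = C ∧ ∀ E, IsLevelComponent G u₀ u₁ i E → E ≠ C → ¬ LinkedAbove G u₀ u₁ i C E)

/-- `x` is a king vertex of `C`. -/
def IsKing {V : Type*} (G : SimpleGraph V) (C : Set V) (x : V) : Prop :=
  x ∈ C ∧ ∀ y ∈ C, y ≠ x → G.Adj x y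

/-- `A` is connected to `B` (some edge joins them), i.e. `A` is not incomplete to `B`. -/
def ConnectedTo {V : Type*} (G : SimpleGraph V) (A B : Set V) : Prop :=
  ∃ x ∈ A, ∃ y ∈ B, G.Adj x y

/-- A simple path of `G₀`: a path with at most one vertex in each level. -/
def IsSimplePath {V : Type*} (G : SimpleGraph V) (u₀ u₁ : V) {x y : V}
    (p : (unboxed G u₀ u₁).Walk x y) : Prop :=
  p.IsPath ∧ ∀ a ∈ p.support, ∀ b ∈ p.support, depth G u₀ u₁ a = depth G u₀ u₁ b → a = b

/-- `D` is a possible choice of `C⁺` when the robber is at `r`: some simple path from `u₁` to `r`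
passes through a vertex `v ∈ C`, and `D` is the level component of the vertex after `v` on it. -/
def IsNextComponent {V : Type*} (G : SimpleGraph V) (u₀ u₁ r : V) (C D : Set V) : Prop :=
  ∃ p : (unboxed G u₀ u₁).Walk u₁ r, IsSimplePath G u₀ u₁ p ∧
    ∃ d ∈ p.darts, d.fst ∈ C ∧ D = levelComponent G u₀ u₁ d.snd

/-! ### The algorithm for three cops -/

/-- In a progressing step, a cop at `k` in the level component `C` with target `k'` is at `v` after
one round and at `k'` after the following one: if `k` is adjacent to `k'` he goes there at once, and
otherwise he goes to a vertex `v` of `C` adjacent to `k'` first. -/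
def IsRoute {V : Type*} (G : SimpleGraph V) (C : Set V) (k k' v : V) : Prop :=
  (G.Adj k k' ∧ v = k') ∨ (¬ G.Adj k k' ∧ v ∈ C ∧ G.Adj v k')

/-- The progressing and synchronizing steps that are available when the chasing cops are at `a`
and `b`, the robber is at `r`, and a simple path is taken through the level component of `a`. A
step is recorded as the list of the pairs of places of these two cops after each of its rounds. -/
inductive Step {V : Type*} (G : SimpleGraph V) (u₀ u₁ r a b : V) : List (V × V) → Prop
  /-- A progressing step in which both cops reach their targets in one round. -/
  | progressOne (P M : Set V) (a' b' : V)
      (hP : IsNextComponent G u₀ u₁ r (levelComponent G u₀ u₁ a) P)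
      (hM : IsMate G u₀ u₁ (depth G u₀ u₁ a + 1) P M)
      (hconn : ConnectedTo G (levelComponent G u₀ u₁ b) M)
      (ha' : IsKing G P a') (hb' : IsKing G M b')
      (ha : G.Adj a a') (hb : G.Adj b b') :
      Step G u₀ u₁ r a b [(a', b')]
  /-- A progressing step in which some cop cannot reach his target in one round. -/
  | progressTwo (P M : Set V) (a' b' v w : V)
      (hP : IsNextComponent G u₀ u₁ r (levelComponent G u₀ u₁ a) P)
      (hM : IsMate G u₀ u₁ (depth G u₀ u₁ a + 1) P M)
      (hconn : ConnectedTo G (levelComponent G u₀ u₁ b) M)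
      (ha' : IsKing G P a') (hb' : IsKing G M b')
      (hab : ¬ (G.Adj a a' ∧ G.Adj b b'))
      (hv : IsRoute G (levelComponent G u₀ u₁ a) a a' v)
      (hw : IsRoute G (levelComponent G u₀ u₁ b) b b' w) :
      Step G u₀ u₁ r a b [(v, w), (a', b')]
  /-- A synchronizing step: the cop at `a` stays and the cop at `b` goes to a king vertex of the
  level component of `a` along a shortest path in `L_{≥ j}`, where `L_j` is the present level. -/
  | synchronize (P M : Set V) (q : V) (p : (unboxed G u₀ u₁).Walk b q)
      (hP : IsNextComponent G u₀ u₁ r (levelComponent G u₀ u₁ a) P)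
      (hM : IsMate G u₀ u₁ (depth G u₀ u₁ a + 1) P M)
      (hinc : ¬ ConnectedTo G (levelComponent G u₀ u₁ b) M)
      (hq : IsKing G (levelComponent G u₀ u₁ a) q)
      (hp : ∀ z ∈ p.support, z ∈ levelGE G u₀ u₁ (depth G u₀ u₁ a))
      (hshort : ∀ (q' : V) (p' : (unboxed G u₀ u₁).Walk b q'),
        IsKing G (levelComponent G u₀ u₁ a) q' →
        (∀ z ∈ p'.support, z ∈ levelGE G u₀ u₁ (depth G u₀ u₁ a)) → p.length ≤ p'.length) :
      Step G u₀ u₁ r a b (p.support.tail.map fun z => (a, z))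

/-- What the cops know between two rounds: the places of `c₀, c₁, c₂`, the vertex `u₁` once it has
been chosen, and the remaining rounds of the step under way (as places of `c₁` and `c₂`). -/
structure AlgState (V : Type*) where
  cop : Fin 3 → V
  gate : Option V
  plan : List (V × V)

/-- `AlgTurn G u₀ s r s'`: the algorithm allows the cops' turn from `s` to `s'` when the robber is
at `r`. -/
inductive AlgTurn {V : Type*} (G : SimpleGraph V) (u₀ : V) : AlgState V → V → AlgState V → Prop
  /-- A robber adjacent to some cop is captured. -/
  | capture (s : AlgState V) (r : V) (i : Fin 3) (h : G.Adj (s.cop i) r) :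
      AlgTurn G u₀ s r ⟨Function.update s.cop i r, s.gate, s.plan⟩
  /-- The cops `c₁, c₂` move to the vertex `u₁` after `u₀` on a shortest path to the robber. -/
  | setup (c : Fin 3 → V) (r : V) (hfree : ∀ i, ¬ G.Adj (c i) r)
      (p : G.Walk u₀ r) (hp : p.length = G.dist u₀ r) :
      AlgTurn G u₀ ⟨c, none, []⟩ r
        ⟨![u₀, p.getVert 1, p.getVert 1], some (p.getVert 1), []⟩
  /-- The step under way is continued. -/
  | resume (c : Fin 3 → V) (u₁ r : V) (m : V × V) (l : List (V × V))
      (hfree : ∀ i, ¬ G.Adj (c i) r) :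
      AlgTurn G u₀ ⟨c, some u₁, m :: l⟩ r ⟨![u₀, m.1, m.2], some u₁, l⟩
  /-- A new step starts, with the path taken through the level component of `c₁`. -/
  | stepFirst (c : Fin 3 → V) (u₁ r : V) (a b : V) (l : List (V × V))
      (hfree : ∀ i, ¬ G.Adj (c i) r) (h : Step G u₀ u₁ r (c 1) (c 2) ((a, b) :: l)) :
      AlgTurn G u₀ ⟨c, some u₁, []⟩ r ⟨![u₀, a, b], some u₁, l⟩
  /-- A new step starts, with the path taken through the level component of `c₂`. -/
  | stepSecond (c : Fin 3 → V) (u₁ r : V) (a b : V) (l : List (V × V))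
      (hfree : ∀ i, ¬ G.Adj (c i) r) (h : Step G u₀ u₁ r (c 2) (c 1) ((b, a) :: l)) :
      AlgTurn G u₀ ⟨c, some u₁, []⟩ r ⟨![u₀, a, b], some u₁, l.map Prod.swap⟩

/-- The robber at `r` shares a vertex with a cop. -/
def Caught {V : Type*} (s : AlgState V) (r : V) : Prop :=
  ∃ i, s.cop i = r

/-- From the state `s` with the robber at `r` and the cops to move, the algorithm captures the
robber within the given number of further rounds, however its free choices are made and however the
robber plays: it never gets stuck, its turns are legal, and the robber is caught in time. -/
def AlgCaptures {V : Type*} (G : SimpleGraph V) (u₀ : V) : ℕ → AlgState V → V → Prop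
  | 0, s, r => Caught s r
  | t + 1, s, r => Caught s r ∨
      ((∃ s', AlgTurn G u₀ s r s') ∧
        ∀ s', AlgTurn G u₀ s r s' → CopMove G s.cop s'.cop ∧
          (Caught s' r ∨ ∀ r', (r' = r ∨ G.Adj r r') → AlgCaptures G u₀ t s' r'))

/-- Started with all three cops on `u₀`, the algorithm captures the robber within the given number
of rounds; placing the players is round one. -/
def AlgCapturesWithin {V : Type*} (G : SimpleGraph V) (u₀ : V) : ℕ → Prop
  | 0 => False
  | t + 1 => ∀ r, AlgCaptures G u₀ t ⟨fun _ => u₀, none, []⟩ r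

end CopsRobber

namespace CopsRobber

/-! ### Claws, even holes and induced paths given as sequences -/

section InducedPaths

variable {V : Type*} {G : SimpleGraph V}

/-! Everything rests on one parity argument. In a claw-free graph two children of a common parent
are adjacent, so nonadjacent vertices of a level have disjoint sets of parents. Descending through
parents adds two edges per level, and so two distinct vertices of a level are joined by an induced
path of odd length with its interior in lower levels (`exists_lower_path`). An induced path above
them whose ends have private parents closes up with such a path to a hole; hence its length is even
(`even_of_indPath`).

Three structural facts follow. Adjacent vertices of a level have nested parent sets
(`parents_nested`), so from level 2 on each level component has a king vertex that sees all parents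
of the component (`exists_dominating_king`). A component with parents in two different components is
linked to no further component of its level (`mem_levelComponent_of_two_parents`). By induction from
the top level downwards, at most two components of a level are linked (`mateUnique`), so mates are
unique.

Consequently two cops on king vertices can shut the robber into a region `R` of the levels above
them; this is the invariant `Chase`. A robber who enters the box is next to `c₀`. One who falls back
to the level below comes next to a chasing cop: by nestedness if the cop has just moved up
(`adj_king_of_adj`), and because squares have chords if the cop is waiting (`adj_waiting_of_adj`).

The time bound counts vertices (`Budget`). With `t` rounds left, `|R| ≤ t` is maintained. A
one-round progressing step removes from `R` a vertex on which a cop lands. A two-round step needs a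
spare round, which `slack` provides: either `|R| < t`, or the only possible door into `R` is the
common place of both cops, and then neither is delayed. A synchronizing step follows a path inside
the larger region `K` of the present level and above; this path avoids `R` (`ncard_add_length_le`),
and `apart` guarantees `|K| ≤ t + 1` while the cops are in different components. The two opening
rounds are paid for by `u₀` and `u₁`, which lie outside the first region. -/

theorem ClawFree.adj_of_adj (h : ClawFree G) {v x y z : V} (hx : G.Adj v x) (hy : G.Adj v y)
    (hz : G.Adj v z) (hxy : x ≠ y) (hxz : x ≠ z) (hyz : y ≠ z) :
    G.Adj x y ∨ G.Adj x z ∨ G.Adj y z := by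
  by_contra! hcon
  obtain ⟨h1, h2, h3⟩ := hcon
  have hinj : Function.Injective (Sum.elim (fun _ : Fin 1 => v) ![x, y, z]) := by
    rintro (a | a) (b | b) hab <;> fin_cases a <;> fin_cases b <;>
      simp_all [hx.ne, hy.ne, hz.ne, hx.ne', hy.ne', hz.ne', eq_comm]
  refine h ⟨⟨⟨_, hinj⟩, ?_⟩⟩
  rintro (a | a) (b | b) <;> simp only [Function.Embedding.coeFn_mk] <;>
    fin_cases a <;> fin_cases b <;> simp_all [completeBipartiteGraph, G.adj_comm]

theorem EvenHoleFree.not_even_cycle (h : EvenHoleFree G) {k : ℕ} (hk : 4 ≤ k) (he : Even k)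
    {c : ℕ → V}
    (hc : ∀ i j, i < j → j < k →
      c i ≠ c j ∧ (G.Adj (c i) (c j) ↔ j = i + 1 ∨ (i = 0 ∧ j + 1 = k))) : False := by
  have hinj : Function.Injective (fun i : Fin k => c i) := by
    intro i j hij
    by_contra hne
    rcases lt_or_gt_of_ne (fun h => hne (Fin.ext h) : i.val ≠ j.val) with h1 | h1
    · exact (hc i j h1 j.2).1 hij
    · exact (hc j i h1 i.2).1 hij.symm
  refine h k hk he ⟨⟨⟨_, hinj⟩, ?_⟩⟩
  · have key : ∀ i j : Fin k, i < j →
        (G.Adj (c i) (c j) ↔ (SimpleGraph.cycleGraph k).Adj i j) := by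
      intro i j hij
      rw [(hc i j hij j.2).2, SimpleGraph.cycleGraph_adj', Fin.sub_def, Fin.sub_def]
      have hi := i.2
      have hj := j.2
      have hij' : i.val < j.val := hij
      simp only
      -- For `i < j` the difference `i - j` wraps around in `Fin k`, whereas `j - i` does not.
      rw [Nat.mod_eq_of_lt (show k - j.val + i.val < k by omega),
        Nat.mod_eq_sub_mod (show k ≤ k - i.val + j.val by omega),
        Nat.mod_eq_of_lt (show k - i.val + j.val - k < k by omega)]
      omega
    intro i j
    simp only [Function.Embedding.coeFn_mk]
    rcases lt_trichotomy i j with h1 | h1 | h1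
    · exact key i j h1
    · subst h1; simp
    · rw [G.adj_comm (c i), SimpleGraph.adj_comm _ i, key j i h1]

/-- The vertices `f 0, …, f n` form an induced path. -/
def IndPath (G : SimpleGraph V) (f : ℕ → V) (n : ℕ) : Prop :=
  ∀ i j, i < j → j ≤ n → f i ≠ f j ∧ (G.Adj (f i) (f j) ↔ j = i + 1)

/-- The sequence `f 0, …, f n, g 0, g 1, …`. -/
def joinSeq (f : ℕ → V) (n : ℕ) (g : ℕ → V) : ℕ → V :=
  fun i => if i ≤ n then f i else g (i - (n + 1))

theorem joinSeq_left {f : ℕ → V} {n : ℕ} {g : ℕ → V} {i : ℕ} (h : i ≤ n) :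
    joinSeq f n g i = f i := if_pos h

theorem joinSeq_right {f : ℕ → V} {n : ℕ} {g : ℕ → V} {i : ℕ} (h : n < i) :
    joinSeq f n g i = g (i - (n + 1)) := if_neg (by omega)

theorem IndPath.adj_succ {f : ℕ → V} {n i : ℕ} (h : IndPath G f n) (hi : i < n) :
    G.Adj (f i) (f (i + 1)) := ((h i (i + 1) (by omega) hi).2).2 rfl

theorem IndPath.reverse {f : ℕ → V} {n : ℕ} (h : IndPath G f n) :
    IndPath G (fun i => f (n - i)) n := by
  intro i j hij hj
  obtain ⟨h1, h2⟩ := h (n - j) (n - i) (by omega) (by omega)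
  refine ⟨h1.symm, ?_⟩
  rw [G.adj_comm, h2]
  omega

theorem IndPath.join {f g : ℕ → V} {n m : ℕ} (hf : IndPath G f n) (hg : IndPath G g m)
    (hfg : ∀ i ≤ n, ∀ j ≤ m, f i ≠ g j ∧ (G.Adj (f i) (g j) ↔ i = n ∧ j = 0)) :
    IndPath G (joinSeq f n g) (n + m + 1) := by
  intro i j hij hj
  rcases le_or_gt j n with hjn | hjn
  · rw [joinSeq_left hjn, joinSeq_left (by omega)]
    exact hf i j hij hjn
  · rw [joinSeq_right hjn]
    rcases le_or_gt i n with hin | hin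
    · rw [joinSeq_left hin]
      obtain ⟨h1, h2⟩ := hfg i hin (j - (n + 1)) (by omega)
      refine ⟨h1, h2.trans ?_⟩
      omega
    · rw [joinSeq_right hin]
      obtain ⟨h1, h2⟩ := hg (i - (n + 1)) (j - (n + 1)) (by omega) (by omega)
      refine ⟨h1, h2.trans ?_⟩
      omega

theorem indPath_const (v : V) : IndPath G (fun _ => v) 0 := by
  intro i j hij hj
  omega

/-- Two disjoint induced paths, joined only at corresponding ends, form a cycle. -/
theorem EvenHoleFree.odd_of_indPaths (h : EvenHoleFree G) {f g : ℕ → V} {n m : ℕ}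
    (hf : IndPath G f n) (hg : IndPath G g m) (hn : 1 ≤ n) (hm : 1 ≤ m)
    (hfg : ∀ i ≤ n, ∀ j ≤ m,
      f i ≠ g j ∧ (G.Adj (f i) (g j) ↔ (i = 0 ∧ j = 0) ∨ (i = n ∧ j = m))) :
    Odd (n + m) := by
  by_contra hodd
  rw [Nat.not_odd_iff_even] at hodd
  -- The second path is traversed backwards: `g m` follows `f n`, and `g 0` closes the cycle at `f
  -- 0`.
  refine h.not_even_cycle (k := n + m + 2) (by omega) (hodd.add (by decide))
    (c := joinSeq f n fun i => g (m - i)) ?_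
  intro i j hij hj
  rcases le_or_gt j n with hjn | hjn
  · rw [joinSeq_left hjn, joinSeq_left (by omega)]
    obtain ⟨h1, h2⟩ := hf i j hij hjn
    refine ⟨h1, h2.trans ?_⟩
    omega
  · rw [joinSeq_right hjn]
    rcases le_or_gt i n with hin | hin
    · rw [joinSeq_left hin]
      obtain ⟨h1, h2⟩ := hfg i hin (m - (j - (n + 1))) (by omega)
      refine ⟨h1, h2.trans ?_⟩
      omega
    · rw [joinSeq_right hin]
      obtain ⟨h1, h2⟩ := hg.reverse (i - (n + 1)) (j - (n + 1)) (by omega) (by omega)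
      refine ⟨h1, h2.trans ?_⟩
      omega

end InducedPaths

/-! ### Components inside a vertex set and shortest paths between sets -/

section Components

variable {V : Type*} {H : SimpleGraph V} {S T : Set V} {x y z : V}

theorem mem_componentIn_self (h : x ∈ S) : x ∈ componentIn H S x :=
  ⟨.nil, by simpa using h⟩

theorem componentIn_subset : componentIn H S x ⊆ S :=
  fun _ ⟨w, hw⟩ => hw _ w.end_mem_support

theorem componentIn_symm (h : y ∈ componentIn H S x) : x ∈ componentIn H S y := by
  obtain ⟨w, hw⟩ := h
  exact ⟨w.reverse, by simpa using hw⟩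

theorem componentIn_trans (h : y ∈ componentIn H S x) (h' : z ∈ componentIn H S y) :
    z ∈ componentIn H S x := by
  obtain ⟨w, hw⟩ := h
  obtain ⟨w', hw'⟩ := h'
  refine ⟨w.append w', fun v hv => ?_⟩
  rcases (SimpleGraph.Walk.mem_support_append_iff _ _).1 hv with hv | hv
  exacts [hw v hv, hw' v hv]

theorem componentIn_step (h : y ∈ componentIn H S x) (hyz : H.Adj y z) (hz : z ∈ S) :
    z ∈ componentIn H S x :=
  componentIn_trans h
    ⟨.cons hyz .nil, by simpa using ⟨componentIn_subset h, hz⟩⟩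

theorem componentIn_mono (h : S ⊆ T) : componentIn H S x ⊆ componentIn H T x :=
  fun _ ⟨w, hw⟩ => ⟨w, fun z hz => h (hw z hz)⟩

theorem componentIn_eq (h : y ∈ componentIn H S x) : componentIn H S y = componentIn H S x :=
  Set.ext fun _ => ⟨componentIn_trans h, componentIn_trans (componentIn_symm h)⟩

/-- A set that contains `x` and is closed under steps inside `S` contains the component of `x`. -/
theorem componentIn_induction {P : V → Prop} (hx : P x)
    (hstep : ∀ y ∈ S, ∀ z ∈ S, P y → H.Adj y z → P z) : ∀ y ∈ componentIn H S x, P y := by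
  rintro y ⟨w, hw⟩
  induction w with
  | nil => exact hx
  | cons h p ih =>
    simp only [SimpleGraph.Walk.support_cons, List.mem_cons, forall_eq_or_imp] at hw
    exact ih (hstep _ hw.1 _ (hw.2 _ p.start_mem_support) hx h) hw.2

/-- A shortest path inside `S` between two sets. -/
theorem exists_indPath_between {A B : Set V} (hx : x ∈ A) (hy : y ∈ B)
    (h : y ∈ componentIn H S x) :
    ∃ (n : ℕ) (f : ℕ → V), f 0 ∈ A ∧ f n ∈ B ∧ (∀ i ≤ n, f i ∈ S) ∧ IndPath H f n ∧
      (∀ i, 0 < i → i ≤ n → f i ∉ A) ∧ ∀ i < n, f i ∉ B := by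
  classical
  let Q : ℕ → Prop := fun n => ∃ f : ℕ → V, f 0 ∈ A ∧ f n ∈ B ∧ (∀ i ≤ n, f i ∈ S) ∧
    ∀ i < n, H.Adj (f i) (f (i + 1))
  have hQ : ∃ n, Q n := by
    obtain ⟨w, hw⟩ := h
    refine ⟨w.length, w.getVert, by simpa using hx, by simpa using hy, fun i _ => ?_,
      fun i hi => w.adj_getVert_succ hi⟩
    exact hw _ (w.getVert_mem_support i)
  obtain ⟨f, hA, hB, hS, hadj⟩ := Nat.find_spec hQ
  have hmin : ∀ m, m < Nat.find hQ → ¬ Q m := fun m hm => Nat.find_min hQ hm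
  generalize Nat.find hQ = n at *
  refine ⟨n, f, hA, hB, hS, ?_, ?_, ?_⟩
  · intro i j hij hj
    constructor
    · intro heq
      -- A repeated vertex allows the part between its two occurrences to be cut out.
      refine hmin (n - (j - i)) (by omega)
        ⟨fun k => if k ≤ i then f k else f (k + (j - i)), by simpa using hA, ?_, ?_, ?_⟩
      · by_cases hk : n - (j - i) ≤ i
        · have h1 : n - (j - i) = i := by omega
          have h2 : j = n := by omega
          subst h2
          dsimp only
          rw [if_pos hk, h1, heq]
          exact hB
        · simp only [hk, if_false]
          rwa [show n - (j - i) + (j - i) = n by omega]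
      · intro k hk
        by_cases hki : k ≤ i
        · simp only [hki, if_true]; exact hS k (by omega)
        · simp only [hki, if_false]; exact hS _ (by omega)
      · intro k hk
        by_cases hki : k + 1 ≤ i
        · simp only [hki, show k ≤ i by omega, if_true]; exact hadj k (by omega)
        · by_cases hki' : k ≤ i
          · have h1 : k = i := by omega
            subst h1
            dsimp only
            rw [if_pos hki', if_neg hki, heq, show k + 1 + (j - k) = j + 1 by omega]
            exact hadj j (by omega)
          · simp only [hki, hki', if_false]
            rw [show k + 1 + (j - i) = k + (j - i) + 1 by omega]
            exact hadj _ (by omega)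
    · refine ⟨fun hc => ?_, fun hc => hc ▸ hadj i (by omega)⟩
      by_contra hne
      -- A chord from `f i` to `f j` is a shortcut past the vertices strictly between them.
      refine hmin (n - (j - i - 1)) (by omega)
        ⟨fun k => if k ≤ i then f k else f (k + (j - i - 1)), by simpa using hA, ?_, ?_, ?_⟩
      · have h1 : ¬ n - (j - i - 1) ≤ i := by omega
        simp only [h1, if_false]
        rwa [show n - (j - i - 1) + (j - i - 1) = n by omega]
      · intro k hk
        by_cases hki : k ≤ i
        · simp only [hki, if_true]; exact hS k (by omega)
        · simp only [hki, if_false]; exact hS _ (by omega)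
      · intro k hk
        by_cases hki : k + 1 ≤ i
        · simp only [hki, show k ≤ i by omega, if_true]; exact hadj k (by omega)
        · by_cases hki' : k ≤ i
          · have h1 : k = i := by omega
            subst h1
            dsimp only
            rw [if_pos hki', if_neg hki, show k + 1 + (j - k - 1) = j by omega]
            exact hc
          · simp only [hki, hki', if_false]
            rw [show k + 1 + (j - i - 1) = k + (j - i - 1) + 1 by omega]
            exact hadj _ (by omega)
  · intro i hi hin hiA
    refine hmin (n - i) (by omega) ⟨fun k => f (k + i), by simpa using hiA, ?_, ?_, ?_⟩
    · simp only [show n - i + i = n by omega]; exact hB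
    · intro k hk; exact hS _ (by omega)
    · intro k hk
      simp only [show k + 1 + i = k + i + 1 by omega]; exact hadj _ (by omega)
  · intro i hi hiB
    exact hmin i hi ⟨f, hA, hiB, fun k hk => hS k (by omega), fun k hk => hadj k (by omega)⟩

end Components

/-! ### Levels and the parity of induced paths -/

section Levels

variable {V : Type*} {G : SimpleGraph V} {u₀ u₁ x y z v : V} {i j : ℕ}

theorem notMem_box_of_reachable (h : (unboxed G u₀ u₁).Reachable u₀ x) : x ∉ box G u₀ u₁ := by
  obtain ⟨w⟩ := h.symm
  cases w with
  | nil => exact fun h => G.irrefl h.1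
  | cons h p => exact h.2.1

theorem unboxed_adj_of_reachable (hx : (unboxed G u₀ u₁).Reachable u₀ x)
    (hy : (unboxed G u₀ u₁).Reachable u₀ y) (h : G.Adj x y) : (unboxed G u₀ u₁).Adj x y :=
  ⟨h, notMem_box_of_reachable hx, notMem_box_of_reachable hy⟩

theorem depth_le_succ (hx : (unboxed G u₀ u₁).Reachable u₀ x) (h : (unboxed G u₀ u₁).Adj x y) :
    depth G u₀ u₁ y ≤ depth G u₀ u₁ x + 1 := by
  obtain ⟨w, hw⟩ := hx.exists_walk_length_eq_dist
  unfold depth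
  rw [← hw]
  exact (SimpleGraph.dist_le (w.concat h)).trans (by simp)

theorem level_le_succ (hx : x ∈ level G u₀ u₁ i) (hy : y ∈ level G u₀ u₁ j) (h : G.Adj x y) :
    j ≤ i + 1 := by
  rw [← hx.2, ← hy.2]
  exact depth_le_succ hx.1 (unboxed_adj_of_reachable hx.1 hy.1 h)

theorem exists_parent (hx : x ∈ level G u₀ u₁ (i + 1)) :
    ∃ y ∈ level G u₀ u₁ i, G.Adj x y := by
  obtain ⟨w, hw⟩ := hx.1.symm.exists_walk_length_eq_dist
  have hd : depth G u₀ u₁ x = i + 1 := hx.2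
  unfold depth at hd
  rw [SimpleGraph.dist_comm] at hd
  cases w with
  | nil => simp at hd
  | @cons _ y _ h p =>
    have hy : (unboxed G u₀ u₁).Reachable u₀ y := hx.1.trans ⟨.cons h .nil⟩
    have h1 : depth G u₀ u₁ y ≤ i := by
      have := SimpleGraph.dist_le p
      rw [SimpleGraph.dist_comm] at this
      simp at hw
      unfold depth
      omega
    have h2 := depth_le_succ hy h.symm
    rw [hx.2] at h2
    exact ⟨y, ⟨hy, by omega⟩, h.1⟩

theorem eq_of_mem_level_zero (hx : x ∈ level G u₀ u₁ 0) : x = u₀ :=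
  (((SimpleGraph.Reachable.dist_eq_zero_iff hx.1).1 hx.2)).symm

theorem eq_of_mem_level_one (hx : x ∈ level G u₀ u₁ 1) : x = u₁ := by
  obtain ⟨y, hy, h⟩ := exists_parent hx
  rw [eq_of_mem_level_zero hy] at h
  by_contra hne
  exact notMem_box_of_reachable hx.1 ⟨h.symm, hne⟩

theorem level_subset_levelGE (h : i ≤ j) : level G u₀ u₁ j ⊆ levelGE G u₀ u₁ i :=
  fun _ hx => ⟨hx.1, hx.2 ▸ h⟩

theorem levelGE_anti (h : i ≤ j) : levelGE G u₀ u₁ j ⊆ levelGE G u₀ u₁ i :=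
  fun _ hx => ⟨hx.1, h.trans hx.2⟩

theorem mem_level_or_of_mem_levelGE (h : x ∈ levelGE G u₀ u₁ i) :
    x ∈ level G u₀ u₁ i ∨ x ∈ levelGE G u₀ u₁ (i + 1) := by
  rcases h.2.eq_or_lt with h' | h'
  exacts [Or.inl ⟨h.1, h'.symm⟩, Or.inr ⟨h.1, h'⟩]

theorem notMem_levelGE_of_mem_level (h : x ∈ level G u₀ u₁ i) (hij : i < j) :
    x ∉ levelGE G u₀ u₁ j := by
  intro h'
  have := h'.2
  have := h.2
  omega

theorem eq_of_mem_level (h : x ∈ level G u₀ u₁ i) (h' : x ∈ level G u₀ u₁ j) : i = j :=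
  h.2.symm.trans h'.2

theorem not_adj_of_level (hx : x ∈ level G u₀ u₁ i) (hy : y ∈ levelGE G u₀ u₁ j)
    (hij : i + 1 < j) : ¬ G.Adj x y := by
  intro h
  have := level_le_succ hx (⟨hy.1, rfl⟩ : y ∈ level G u₀ u₁ _) h
  have := hy.2
  omega

theorem mem_level_of_adj (hx : x ∈ level G u₀ u₁ i) (hy : y ∈ levelGE G u₀ u₁ (i + 1))
    (h : G.Adj x y) : y ∈ level G u₀ u₁ (i + 1) := by
  have := level_le_succ hx (⟨hy.1, rfl⟩ : y ∈ level G u₀ u₁ _) h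
  have := hy.2
  exact ⟨hy.1, by omega⟩

/-- Otherwise `x`, `y` and a parent of `v` are the leaves of a claw centred at `v`. If `v` is `u₀`
it has no parent, but then `x = y = u₁`. -/
theorem adj_of_common_parent (hclaw : ClawFree G) (hv : v ∈ level G u₀ u₁ i)
    (hx : x ∈ level G u₀ u₁ (i + 1)) (hy : y ∈ level G u₀ u₁ (i + 1)) (hvx : G.Adj v x)
    (hvy : G.Adj v y) (hne : x ≠ y) : G.Adj x y := by
  rcases i with _ | i
  · exact absurd ((eq_of_mem_level_one hx).trans (eq_of_mem_level_one hy).symm) hne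
  · obtain ⟨p, hp, hvp⟩ := exists_parent hv
    have hpx : ¬ G.Adj x p := fun h => not_adj_of_level hp (level_subset_levelGE le_rfl hx)
      (by omega) h.symm
    have hpy : ¬ G.Adj y p := fun h => not_adj_of_level hp (level_subset_levelGE le_rfl hy)
      (by omega) h.symm
    have hxp : x ≠ p := by
      rintro rfl
      have := eq_of_mem_level hx hp
      omega
    have hyp : y ≠ p := by
      rintro rfl
      have := eq_of_mem_level hy hp
      omega
    rcases hclaw.adj_of_adj hvx hvy hvp hne hxp hyp with h | h | h
    exacts [h, absurd h hpx, absurd h hpy]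

/-- Adjacent vertices form a path of length one. Nonadjacent ones have no common parent, so an odd
path between a parent of each, extended at both ends, is again induced and two edges longer. The
recursion stops at the latest at level 1, which has only one vertex. -/
theorem exists_lower_path (hclaw : ClawFree G) (i : ℕ) :
    ∀ p ∈ level G u₀ u₁ (i + 1), ∀ q ∈ level G u₀ u₁ (i + 1), p ≠ q →
      ∃ (m : ℕ) (f : ℕ → V), Odd m ∧ IndPath G f m ∧ f 0 = p ∧ f m = q ∧
        ∀ k, 0 < k → k < m → ∃ i' ≤ i, f k ∈ level G u₀ u₁ i' := by
  induction i with
  | zero =>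
    intro p hp q hq hne
    exact absurd ((eq_of_mem_level_one hp).trans (eq_of_mem_level_one hq).symm) hne
  | succ i ih =>
    intro p hp q hq hne
    by_cases hpq : G.Adj p q
    · refine ⟨1, fun k => if k = 0 then p else q, odd_one, ?_, by simp, by simp,
        fun k _ _ => by omega⟩
      intro a b hab hb
      obtain ⟨rfl, rfl⟩ : a = 0 ∧ b = 1 := by omega
      simpa using ⟨hne, hpq⟩
    obtain ⟨p', hp', hpp'⟩ := exists_parent hp
    obtain ⟨q', hq', hqq'⟩ := exists_parent hq
    have hpq' : ¬ G.Adj p q' := fun h =>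
      hpq (adj_of_common_parent hclaw hq' hp hq h.symm hqq'.symm hne)
    have hqp' : ¬ G.Adj p' q := fun h =>
      hpq (adj_of_common_parent hclaw hp' hp hq hpp'.symm h hne)
    obtain ⟨m, f, hm, hf, rfl, rfl, hlow⟩ := ih p' hp' q' hq' (by rintro rfl; exact hpq' hpp')
    have hlev : ∀ k ≤ m, ∃ i' ≤ i + 1, f k ∈ level G u₀ u₁ i' := by
      intro k hk
      rcases Nat.eq_zero_or_pos k with rfl | h0
      · exact ⟨_, le_rfl, hp'⟩
      rcases hk.eq_or_lt with rfl | h1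
      · exact ⟨_, le_rfl, hq'⟩
      obtain ⟨i', hi', h⟩ := hlow k h0 h1
      exact ⟨i', by omega, h⟩
    have hne' : ∀ k ≤ m, ∀ z ∈ level G u₀ u₁ (i + 1 + 1), z ≠ f k := by
      rintro k hk z hz rfl
      obtain ⟨i', hi', h⟩ := hlev k hk
      have := eq_of_mem_level h hz
      omega
    have hnadj : ∀ k, 0 < k → k < m → ∀ z ∈ level G u₀ u₁ (i + 1 + 1), ¬ G.Adj (f k) z := by
      intro k h0 h1 z hz
      obtain ⟨i', hi', h⟩ := hlow k h0 h1
      exact not_adj_of_level h (level_subset_levelGE le_rfl hz) (by omega)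
    have h1 : IndPath G (joinSeq (fun _ => p) 0 f) (0 + m + 1) := by
      refine (indPath_const p).join hf fun a ha b hb => ⟨hne' b hb p hp, ?_⟩
      refine ⟨fun h => ⟨by omega, ?_⟩, fun h => h.2 ▸ hpp'⟩
      by_contra h0
      rcases hb.eq_or_lt with rfl | h2
      exacts [hpq' h, hnadj b (by omega) h2 p hp h.symm]
    have hval : ∀ a, 0 < a → a ≤ 0 + m + 1 → joinSeq (fun _ => p) 0 f a = f (a - 1) :=
      fun a ha _ => joinSeq_right ha
    have h2 : IndPath G (joinSeq (joinSeq (fun _ => p) 0 f) (0 + m + 1) (fun _ => q))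
        (0 + m + 1 + 0 + 1) := by
      refine h1.join (indPath_const q) fun a ha b hb => ?_
      rcases Nat.eq_zero_or_pos a with rfl | h0
      · refine ⟨by simpa [joinSeq] using hne, ⟨fun h => ?_, fun h => by omega⟩⟩
        exact absurd (by simpa [joinSeq] using h) hpq
      · rw [hval a h0 ha]
        refine ⟨(hne' _ (by omega) q hq).symm, ⟨fun h => ⟨?_, by omega⟩, fun h => ?_⟩⟩
        · by_contra hcon
          rcases Nat.eq_zero_or_pos (a - 1) with h3 | h3
          · exact hqp' (h3 ▸ h)
          · exact hnadj _ h3 (by omega) q hq h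
        · rw [h.1, show 0 + m + 1 - 1 = m by omega]; exact hqq'.symm
    refine ⟨_, _, ?_, h2, by simp [joinSeq], by simp [joinSeq], ?_⟩
    · rw [show 0 + m + 1 + 0 + 1 = m + 2 by omega]
      exact hm.add_even (by decide)
    · intro k hk0 hk
      rw [joinSeq_left (by omega), hval k hk0 (by omega)]
      exact hlev _ (by omega)

/-- Upper induced paths whose ends have private parents have even length. -/
theorem even_of_indPath (hclaw : ClawFree G) (heven : EvenHoleFree G) {p q : V} {f : ℕ → V} {n : ℕ}
    (hp : p ∈ level G u₀ u₁ (i + 1)) (hq : q ∈ level G u₀ u₁ (i + 1)) (hpq : p ≠ q)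
    (hf : IndPath G f n) (hlev : ∀ k ≤ n, f k ∈ levelGE G u₀ u₁ (i + 2))
    (hp0 : G.Adj p (f 0)) (hp1 : ∀ k, 0 < k → k ≤ n → ¬ G.Adj p (f k))
    (hq0 : G.Adj q (f n)) (hq1 : ∀ k < n, ¬ G.Adj q (f k)) : Even n := by
  obtain ⟨m, g, hm, hg, rfl, rfl, hlow⟩ := exists_lower_path hclaw i p hp q hq hpq
  -- Length zero is even anyway; closing up to a cycle needs at least one edge on each side.
  rcases Nat.eq_zero_or_pos n with rfl | hn
  · exact Even.zero
  have hglev : ∀ k ≤ m, ∃ i' ≤ i + 1, g k ∈ level G u₀ u₁ i' := by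
    intro k hk
    rcases Nat.eq_zero_or_pos k with rfl | h0
    · exact ⟨_, le_rfl, hp⟩
    rcases hk.eq_or_lt with rfl | h1
    · exact ⟨_, le_rfl, hq⟩
    obtain ⟨i', hi', h⟩ := hlow k h0 h1
    exact ⟨i', by omega, h⟩
  have hodd := heven.odd_of_indPaths hf hg hn (by obtain ⟨a, rfl⟩ := hm; omega) ?_
  · by_contra hcon
    rw [Nat.not_even_iff_odd] at hcon
    exact Nat.not_odd_iff_even.2 (hcon.add_odd hm) hodd
  · intro a ha b hb
    constructor
    · intro heq
      obtain ⟨i', hi', h⟩ := hglev b hb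
      exact notMem_levelGE_of_mem_level h (by omega) (heq ▸ hlev a ha)
    · constructor
      · intro hadj
        rcases Nat.eq_zero_or_pos b with rfl | h0
        · rcases Nat.eq_zero_or_pos a with rfl | h1
          · exact Or.inl ⟨rfl, rfl⟩
          · exact absurd hadj.symm (hp1 a h1 ha)
        rcases hb.eq_or_lt with rfl | h1
        · rcases ha.eq_or_lt with rfl | h1
          · exact Or.inr ⟨rfl, rfl⟩
          · exact absurd hadj.symm (hq1 a h1)
        · obtain ⟨i', hi', h⟩ := hlow b h0 h1
          exact absurd hadj.symm (not_adj_of_level h (hlev a ha) (by omega))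
      · rintro (⟨rfl, rfl⟩ | ⟨rfl, rfl⟩)
        exacts [hp0.symm, hq0.symm]

end Levels

end CopsRobber

namespace CopsRobber

/-! ### Parent sets, king vertices and components with two parent components -/

section Structure

variable {V : Type*} {G : SimpleGraph V} {u₀ u₁ x y z p q r : V} {i j : ℕ}

theorem levelComponent_eq_componentIn (hx : x ∈ level G u₀ u₁ i) :
    levelComponent G u₀ u₁ x = componentIn (unboxed G u₀ u₁) (level G u₀ u₁ i) x := by
  rw [levelComponent, show depth G u₀ u₁ x = i from hx.2]

theorem mem_levelComponent_self (hx : x ∈ level G u₀ u₁ i) : x ∈ levelComponent G u₀ u₁ x := by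
  rw [levelComponent_eq_componentIn hx]
  exact mem_componentIn_self hx

theorem levelComponent_subset (hx : x ∈ level G u₀ u₁ i) :
    levelComponent G u₀ u₁ x ⊆ level G u₀ u₁ i := by
  rw [levelComponent_eq_componentIn hx]
  exact componentIn_subset

theorem levelComponent_eq (hx : x ∈ level G u₀ u₁ i) (hy : y ∈ levelComponent G u₀ u₁ x) :
    levelComponent G u₀ u₁ y = levelComponent G u₀ u₁ x := by
  rw [levelComponent_eq_componentIn (levelComponent_subset hx hy)]
  rw [levelComponent_eq_componentIn hx] at hy ⊢
  exact componentIn_eq hy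

theorem mem_levelComponent_comm (hx : x ∈ level G u₀ u₁ i)
    (h : y ∈ levelComponent G u₀ u₁ x) : x ∈ levelComponent G u₀ u₁ y := by
  rw [levelComponent_eq hx h]
  exact mem_levelComponent_self hx

theorem mem_levelComponent_of_adj (hx : x ∈ level G u₀ u₁ i)
    (hy : y ∈ levelComponent G u₀ u₁ x) (hz : z ∈ level G u₀ u₁ i) (h : G.Adj y z) :
    z ∈ levelComponent G u₀ u₁ x := by
  have hyi := levelComponent_subset hx hy
  rw [levelComponent_eq_componentIn hx] at hy ⊢
  exact componentIn_step hy (unboxed_adj_of_reachable hyi.1 hz.1 h) hz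

theorem levelComponent_subset_componentIn (hx : x ∈ level G u₀ u₁ i) :
    levelComponent G u₀ u₁ x ⊆ componentIn (unboxed G u₀ u₁) (levelGE G u₀ u₁ i) x := by
  rw [levelComponent_eq_componentIn hx]
  exact componentIn_mono (level_subset_levelGE le_rfl)

/-- The connected component of `x` in `G₀[L_{≥ i}]`. -/
abbrev region (G : SimpleGraph V) (u₀ u₁ : V) (i : ℕ) (x : V) : Set V :=
  componentIn (unboxed G u₀ u₁) (levelGE G u₀ u₁ i) x

/-- `x` has a neighbour in the component of `r` in `G₀[L_{≥ i}]`. -/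
def Attached (G : SimpleGraph V) (u₀ u₁ : V) (i : ℕ) (r x : V) : Prop :=
  ∃ z ∈ region G u₀ u₁ i r, G.Adj x z

theorem region_step (hy : y ∈ region G u₀ u₁ i x) (hz : z ∈ levelGE G u₀ u₁ i) (h : G.Adj y z) :
    z ∈ region G u₀ u₁ i x :=
  componentIn_step hy (unboxed_adj_of_reachable (componentIn_subset hy).1 hz.1 h) hz

theorem IndPath.of_unboxed {f : ℕ → V} {n : ℕ} (hf : IndPath (unboxed G u₀ u₁) f n)
    (hlev : ∀ k ≤ n, f k ∈ levelGE G u₀ u₁ i) : IndPath G f n := by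
  intro a b hab hb
  obtain ⟨h1, h2⟩ := hf a b hab hb
  exact ⟨h1, ⟨fun h => h2.1 (unboxed_adj_of_reachable (hlev a (by omega)).1 (hlev b hb).1 h),
    fun h => (h2.2 h).1⟩⟩

theorem ne_of_level (hx : x ∈ level G u₀ u₁ i) (hy : y ∈ levelGE G u₀ u₁ j) (h : i < j) :
    x ≠ y := by
  rintro rfl
  exact notMem_levelGE_of_mem_level hx h hy

/-- If `p` and `q` were private parents, the edge `xy` would be an upper induced path of odd length
one. -/
theorem parents_nested (hclaw : ClawFree G) (heven : EvenHoleFree G)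
    (hx : x ∈ level G u₀ u₁ (i + 2)) (hy : y ∈ level G u₀ u₁ (i + 2)) (hxy : G.Adj x y)
    (hp : p ∈ level G u₀ u₁ (i + 1)) (hq : q ∈ level G u₀ u₁ (i + 1)) (hpx : G.Adj p x)
    (hqy : G.Adj q y) : G.Adj p y ∨ G.Adj q x := by
  by_contra! hcon
  refine (by decide : ¬ Even 1) (even_of_indPath hclaw heven (f := fun k => if k = 0 then x else y)
    (n := 1) hp hq ?_ ?_ ?_ (by simpa) ?_ (by simpa) ?_)
  · rintro rfl
    exact hcon.1 hqy
  · intro a b hab hb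
    obtain ⟨rfl, rfl⟩ : a = 0 ∧ b = 1 := by omega
    simpa using ⟨hxy.ne, hxy⟩
  · intro k hk
    rcases Nat.eq_zero_or_pos k with rfl | h0
    · simpa using level_subset_levelGE le_rfl hx
    · simpa [h0.ne'] using level_subset_levelGE le_rfl hy
  · intro k hk hk1
    simpa [hk.ne'] using hcon.1
  · intro k hk
    obtain rfl : k = 0 := by omega
    simpa using hcon.2

/-- Every level component has a king vertex adjacent to all parents of the component. -/
theorem exists_dominating_king [Finite V] (hclaw : ClawFree G) (heven : EvenHoleFree G)
    (hx : x ∈ level G u₀ u₁ (i + 2)) :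
    ∃ d, IsKing G (levelComponent G u₀ u₁ x) d ∧
      ∀ e ∈ levelComponent G u₀ u₁ x, ∀ p ∈ level G u₀ u₁ (i + 1), G.Adj p e → G.Adj p d := by
  -- The king is a vertex whose set of parents is maximal under inclusion; by nestedness it contains
  -- the parent set of each neighbour of `d` in the component.
  obtain ⟨d, hd, hmax⟩ := (Set.toFinite (levelComponent G u₀ u₁ x)).exists_maximalFor
    (fun e => {p | p ∈ level G u₀ u₁ (i + 1) ∧ G.Adj p e}) _ ⟨x, mem_levelComponent_self hx⟩
  have hdl := levelComponent_subset hx hd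
  have hdom : ∀ e ∈ levelComponent G u₀ u₁ x, G.Adj d e → ∀ p ∈ level G u₀ u₁ (i + 1),
      G.Adj p e → G.Adj p d := by
    intro e he hde p hp hpe
    by_contra hpd
    have hel := levelComponent_subset hx he
    have hsub : ∀ q, q ∈ level G u₀ u₁ (i + 1) ∧ G.Adj q e →
        q ∈ level G u₀ u₁ (i + 1) ∧ G.Adj q d := hmax he fun q hq => ⟨hq.1,
      (parents_nested hclaw heven hdl hel hde hq.1 hp hq.2 hpe).resolve_right hpd⟩
    exact hpd (hsub p ⟨hp, hpe⟩).2
  have hking : ∀ e ∈ levelComponent G u₀ u₁ d, e ∈ levelComponent G u₀ u₁ x ∧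
      (e = d ∨ G.Adj d e) := by
    rw [levelComponent_eq_componentIn hdl]
    refine componentIn_induction ⟨hd, Or.inl rfl⟩ ?_
    rintro y hy z hz ⟨hyx, hyd⟩ hyz
    have hzx := mem_levelComponent_of_adj hx hyx hz hyz.1
    refine ⟨hzx, ?_⟩
    by_contra! hcon
    rcases hyd with rfl | hyd
    · exact hcon.2 hyz.1
    -- A common parent of `y` and `z` would also be a parent of `d`, by domination along the edge
    -- `dy`, and would make `d` and `z` adjacent. But the edge `yz` forces a common parent.
    have hcommon : ∀ p ∈ level G u₀ u₁ (i + 1), G.Adj p y → ¬ G.Adj p z := fun p hp hpy hpz =>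
      hcon.2 (adj_of_common_parent hclaw hp hdl hz (hdom y hyx hyd p hp hpy) hpz hcon.1.symm)
    obtain ⟨p, hp, hpy⟩ := exists_parent hy
    obtain ⟨q, hq, hqz⟩ := exists_parent hz
    rcases parents_nested hclaw heven hy hz hyz.1 hp hq hpy.symm hqz.symm with h | h
    exacts [hcommon p hp hpy.symm h, hcommon q hq h hqz.symm]
  rw [levelComponent_eq hx hd] at hking
  refine ⟨d, ⟨hd, fun y hy hne => (hking y hy).2.resolve_left hne⟩, fun e he p hp hpe => ?_⟩
  rcases (hking e he).2 with rfl | h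
  exacts [hpe, hdom e he h p hp hpe]

/-- The vertices `p`, `q` and a child `w` would be the leaves of a claw centred at `d`. -/
theorem not_adj_child (hclaw : ClawFree G) {d w : V}
    (hp : p ∈ level G u₀ u₁ i) (hq : q ∈ level G u₀ u₁ i) (hpq : p ≠ q)
    (hnadj : ¬ G.Adj p q) (hpd : G.Adj p d) (hqd : G.Adj q d)
    (hw : w ∈ levelGE G u₀ u₁ (i + 2)) : ¬ G.Adj d w := by
  intro h
  rcases hclaw.adj_of_adj hpd.symm hqd.symm h hpq (ne_of_level hp hw (by omega))
    (ne_of_level hq hw (by omega)) with h | h | h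
  exacts [hnadj h, not_adj_of_level hp hw (by omega) h, not_adj_of_level hq hw (by omega) h]

/-- A level component with parents in two components is linked to no other component. -/
theorem mem_levelComponent_of_two_parents [Finite V] (hclaw : ClawFree G) (heven : EvenHoleFree G)
    {p₁ p₂ e₁ e₂ : V} (hx : x ∈ level G u₀ u₁ (i + 2)) (hp₁ : p₁ ∈ level G u₀ u₁ (i + 1))
    (hp₂ : p₂ ∈ level G u₀ u₁ (i + 1)) (hne : p₂ ∉ levelComponent G u₀ u₁ p₁)
    (he₁ : e₁ ∈ levelComponent G u₀ u₁ x) (he₂ : e₂ ∈ levelComponent G u₀ u₁ x)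
    (hpe₁ : G.Adj p₁ e₁) (hpe₂ : G.Adj p₂ e₂) (hy : y ∈ level G u₀ u₁ (i + 2))
    (hxy : y ∈ region G u₀ u₁ (i + 2) x) : y ∈ levelComponent G u₀ u₁ x := by
  by_contra hyx
  obtain ⟨d, hd, hdom⟩ := exists_dominating_king hclaw heven hx
  have hdl := levelComponent_subset hx hd.1
  have hp₁d := hdom e₁ he₁ p₁ hp₁ hpe₁
  have hp₂d := hdom e₂ he₂ p₂ hp₂ hpe₂
  have hp₁₂ : p₁ ≠ p₂ := by rintro rfl; exact hne (mem_levelComponent_self hp₁)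
  have hnadj : ¬ G.Adj p₁ p₂ := fun h =>
    hne (mem_levelComponent_of_adj hp₁ (mem_levelComponent_self hp₁) hp₂ h)
  -- The idea is to compare a shortest path to another component with the same path preceded by the
  -- king `d`. Both have private parents at their ends, so both lengths would be even.
  obtain ⟨n, f, hf0, hfn, hfS, hf, hfA, hfB⟩ :=
    exists_indPath_between (A := levelComponent G u₀ u₁ x)
      (B := level G u₀ u₁ (i + 2) \ levelComponent G u₀ u₁ x) (mem_levelComponent_self hx)
      ⟨hy, hyx⟩ hxy
  replace hf := hf.of_unboxed hfS
  have hf0l := levelComponent_subset hx hf0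
  have hint : ∀ k, 0 < k → k < n → f k ∈ levelGE G u₀ u₁ (i + 3) := by
    intro k h0 hk
    refine (mem_level_or_of_mem_levelGE (hfS k hk.le)).resolve_left fun h => ?_
    exact hfB k hk ⟨h, hfA k h0 hk.le⟩
  have hnpos : 0 < n := by
    rcases Nat.eq_zero_or_pos n with rfl | h
    exacts [absurd hf0 hfn.2, h]
  have hnoadj : ∀ e ∈ levelComponent G u₀ u₁ x, ¬ G.Adj e (f n) := fun e he h =>
    hfn.2 (mem_levelComponent_of_adj hx he hfn.1 h)
  have hn1 : 1 < n := by
    by_contra hcon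
    obtain rfl : n = 1 := by omega
    exact hnoadj _ hf0 (hf.adj_succ hnpos)
  have hchild := hint 1 one_pos hn1
  have hnochild : ∀ w ∈ levelGE G u₀ u₁ (i + 3), ¬ G.Adj d w := fun w hw =>
    not_adj_child hclaw hp₁ hp₂ hp₁₂ hnadj hp₁d hp₂d hw
  have hd0 : d ≠ f 0 := by
    intro h
    exact hnochild _ hchild (h ▸ hf.adj_succ hnpos)
  have hsep : ∀ q ∈ level G u₀ u₁ (i + 1), ∀ e ∈ levelComponent G u₀ u₁ x, G.Adj q e →
      ¬ G.Adj q (f n) := by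
    intro q hq e he hqe hqn
    have hen : e ≠ f n := by rintro rfl; exact hfn.2 he
    exact hnoadj e he
      (adj_of_common_parent hclaw hq (levelComponent_subset hx he) hfn.1 hqe hqn hen)
  obtain ⟨s, hs, hsn⟩ := exists_parent hfn.1
  obtain ⟨t, ht, ht0⟩ := exists_parent hf0l
  -- Since `f 0` has the child `f 1`, it cannot be adjacent to both `p₁` and `p₂`. One of them is
  -- thus a parent of `d` that misses `f 0`.
  obtain ⟨p, hp, hpd, hp0⟩ : ∃ p ∈ level G u₀ u₁ (i + 1), G.Adj p d ∧ ¬ G.Adj p (f 0) := by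
    by_contra! hcon
    exact not_adj_child hclaw hp₁ hp₂ hp₁₂ hnadj (hcon p₁ hp₁ hp₁d) (hcon p₂ hp₂ hp₂d)
      hchild (hf.adj_succ hnpos)
  have hlow : ∀ q ∈ level G u₀ u₁ (i + 1), ∀ k, 0 < k → k < n → ¬ G.Adj q (f k) :=
    fun q hq k h0 hk => not_adj_of_level hq (hint k h0 hk) (by omega)
  have heven₁ : Even n := by
    refine even_of_indPath hclaw heven ht hs ?_ hf hfS ht0.symm ?_ hsn.symm ?_
    · rintro rfl
      exact hsep t ht _ hf0 ht0.symm hsn.symm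
    · intro k h0 hk
      rcases hk.eq_or_lt with rfl | hk
      exacts [hsep t ht _ hf0 ht0.symm, hlow t ht k h0 hk]
    · intro k hk
      rcases Nat.eq_zero_or_pos k with rfl | h0
      exacts [fun h => hsep s hs _ hf0 h hsn.symm, hlow s hs k h0 hk]
  have hval : ∀ k, 0 < k → joinSeq (fun _ => d) 0 f k = f (k - 1) := fun k hk => joinSeq_right hk
  have hval0 : joinSeq (fun _ => d) 0 f 0 = d := rfl
  have heven₂ : Even (0 + n + 1) := by
    refine even_of_indPath hclaw heven (f := joinSeq (fun _ => d) 0 f) hp hs ?_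
      ((indPath_const d).join hf ?_) ?_ hpd ?_ ?_ ?_
    · rintro rfl
      exact hsep p hp d hd.1 hpd hsn.symm
    · intro a ha b hb
      obtain rfl : a = 0 := by omega
      constructor
      · rcases Nat.eq_zero_or_pos b with rfl | h0
        · exact hd0
        · rintro rfl
          exact hfA b h0 hb hd.1
      · refine ⟨fun h => ⟨rfl, ?_⟩, ?_⟩
        · by_contra hb0
          rcases hb.eq_or_lt with rfl | hb
          · exact hnoadj d hd.1 h
          · exact hnochild _ (hint b (by omega) hb) h
        · rintro ⟨-, rfl⟩
          exact hd.2 _ hf0 hd0.symm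
    · intro k hk
      rcases Nat.eq_zero_or_pos k with rfl | h0
      · exact level_subset_levelGE le_rfl hdl
      · rw [hval k h0]
        exact hfS _ (by omega)
    · intro k h0 hk
      rw [hval k h0]
      rcases Nat.eq_zero_or_pos (k - 1) with h1 | h1
      · rwa [h1]
      · rcases (show k - 1 ≤ n by omega).eq_or_lt with h2 | h2
        · rw [h2]
          exact hsep p hp d hd.1 hpd
        · exact hlow p hp _ h1 h2
    · rw [hval _ (by omega), show 0 + n + 1 - 1 = n by omega]
      exact hsn.symm
    · intro k hk
      rcases Nat.eq_zero_or_pos k with rfl | h0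
      · exact fun h => hsep s hs d hd.1 h hsn.symm
      · rw [hval k h0]
        rcases Nat.eq_zero_or_pos (k - 1) with h1 | h1
        · rw [h1]
          exact fun h => hsep s hs _ hf0 h hsn.symm
        · exact hlow s hs _ h1 (by omega)
  rw [zero_add, Nat.even_add_one] at heven₂
  exact heven₂ heven₁

end Structure

end CopsRobber

namespace CopsRobber

/-! ### At most two components of a level are linked -/

section Mates

variable {V : Type*} {G : SimpleGraph V} {u₀ u₁ x y z p q r : V} {i j : ℕ}

theorem ne_of_notMem_levelComponent (hx : x ∈ level G u₀ u₁ i)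
    (h : y ∉ levelComponent G u₀ u₁ x) : x ≠ y := by
  rintro rfl
  exact h (mem_levelComponent_self hx)

theorem not_adj_of_notMem_levelComponent (hx : x ∈ level G u₀ u₁ i) (hy : y ∈ level G u₀ u₁ i)
    (h : y ∉ levelComponent G u₀ u₁ x) : ¬ G.Adj x y := fun h' =>
  h (mem_levelComponent_of_adj hx (mem_levelComponent_self hx) hy h')

/-- Among three linked vertices of a level, two are in the same level component. -/
def MateUnique (G : SimpleGraph V) (u₀ u₁ : V) (j : ℕ) : Prop :=
  ∀ x ∈ level G u₀ u₁ j, ∀ y ∈ level G u₀ u₁ j, ∀ z ∈ level G u₀ u₁ j,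
    y ∈ region G u₀ u₁ j x → z ∈ region G u₀ u₁ j x →
    y ∈ levelComponent G u₀ u₁ x ∨ z ∈ levelComponent G u₀ u₁ x ∨ z ∈ levelComponent G u₀ u₁ y

/-- A component with parents in two components is linked to no other, so `ez` lies in it too. Its
dominating king then sees `x`, `y` and `z`, which form a claw with it. -/
theorem not_three_parents [Finite V] (hclaw : ClawFree G) (heven : EvenHoleFree G) {ex ey ez : V}
    (hx : x ∈ level G u₀ u₁ (i + 1)) (hy : y ∈ level G u₀ u₁ (i + 1))
    (hz : z ∈ level G u₀ u₁ (i + 1)) (hxy : y ∉ levelComponent G u₀ u₁ x)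
    (hxz : z ∉ levelComponent G u₀ u₁ x) (hyz : z ∉ levelComponent G u₀ u₁ y)
    (hex : ex ∈ level G u₀ u₁ (i + 2)) (hez : ez ∈ level G u₀ u₁ (i + 2))
    (hey : ey ∈ levelComponent G u₀ u₁ ex) (hez' : ez ∈ region G u₀ u₁ (i + 2) ex)
    (hxe : G.Adj x ex) (hye : G.Adj y ey) (hze : G.Adj z ez) : False := by
  have hself := mem_levelComponent_self hex
  have hez'' := mem_levelComponent_of_two_parents hclaw heven hex hx hy hxy hself hey hxe hye hez
    hez'
  obtain ⟨d, hd, hdom⟩ := exists_dominating_king hclaw heven hex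
  rcases hclaw.adj_of_adj (hdom _ hself x hx hxe).symm (hdom _ hey y hy hye).symm
    (hdom _ hez'' z hz hze).symm (ne_of_notMem_levelComponent hx hxy)
    (ne_of_notMem_levelComponent hx hxz) (ne_of_notMem_levelComponent hy hyz) with h | h | h
  exacts [not_adj_of_notMem_levelComponent hx hy hxy h,
    not_adj_of_notMem_levelComponent hx hz hxz h, not_adj_of_notMem_levelComponent hy hz hyz h]

/-- Of three children in one region, two share a component by the hypothesis on the level above, and
`not_three_parents` applies to that pair. The property thus descends one level, but for a single
region only. -/
theorem MateUnique.attached [Finite V] (hclaw : ClawFree G) (heven : EvenHoleFree G)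
    (hM : MateUnique G u₀ u₁ (i + 2)) (hx : x ∈ level G u₀ u₁ (i + 1))
    (hy : y ∈ level G u₀ u₁ (i + 1)) (hz : z ∈ level G u₀ u₁ (i + 1))
    (hrx : Attached G u₀ u₁ (i + 2) r x) (hry : Attached G u₀ u₁ (i + 2) r y)
    (hrz : Attached G u₀ u₁ (i + 2) r z) :
    y ∈ levelComponent G u₀ u₁ x ∨ z ∈ levelComponent G u₀ u₁ x ∨
      z ∈ levelComponent G u₀ u₁ y := by
  by_contra! hcon
  obtain ⟨hxy, hxz, hyz⟩ := hcon
  obtain ⟨ex, hex, hxe⟩ := hrx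
  obtain ⟨ey, hey, hye⟩ := hry
  obtain ⟨ez, hez, hze⟩ := hrz
  have hexl := mem_level_of_adj hx (componentIn_subset hex) hxe
  have heyl := mem_level_of_adj hy (componentIn_subset hey) hye
  have hezl := mem_level_of_adj hz (componentIn_subset hez) hze
  have link : ∀ {a b}, a ∈ region G u₀ u₁ (i + 2) r → b ∈ region G u₀ u₁ (i + 2) r →
      b ∈ region G u₀ u₁ (i + 2) a := fun ha hb => componentIn_trans (componentIn_symm ha) hb
  rcases hM ex hexl ey heyl ez hezl (link hex hey) (link hex hez) with h | h | h
  · exact not_three_parents hclaw heven hx hy hz hxy hxz hyz hexl hezl h (link hex hez) hxe hye hze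
  · exact not_three_parents hclaw heven hx hz hy hxz hxy
      (fun h => hyz (mem_levelComponent_comm hz h)) hexl heyl h (link hex hey) hxe hze hye
  · exact not_three_parents hclaw heven hy hz hx hyz
      (fun h => hxy (mem_levelComponent_comm hy h)) (fun h => hxz (mem_levelComponent_comm hz h))
      heyl hexl h (link hey hex) hye hze hxe

/-- Two components attached to a region are joined through it by an induced path of even length. -/
theorem exists_even_path (hclaw : ClawFree G) (heven : EvenHoleFree G) {a b : V}
    (ha : a ∈ level G u₀ u₁ (i + 2)) (hb : b ∈ level G u₀ u₁ (i + 2))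
    (hab : a ∉ levelComponent G u₀ u₁ b) (hra : Attached G u₀ u₁ (i + 3) r a)
    (hrb : Attached G u₀ u₁ (i + 3) r b) :
    ∃ (n : ℕ) (f : ℕ → V), 1 < n ∧ Even n ∧ IndPath G f n ∧ f 0 ∈ levelComponent G u₀ u₁ a ∧
      f n = b ∧ ∀ k, 0 < k → k < n → f k ∈ region G u₀ u₁ (i + 3) r := by
  obtain ⟨ea, hea, hae⟩ := hra
  obtain ⟨eb, heb, hbe⟩ := hrb
  have hba : b ∉ levelComponent G u₀ u₁ a := fun h => hab (mem_levelComponent_comm ha h)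
  -- Of the component of `b` only `b` itself is admitted, so that the path ends exactly there; at
  -- the other end any vertex of the component of `a` is allowed.
  set S : Set V := region G u₀ u₁ (i + 3) r ∪ (levelComponent G u₀ u₁ a ∪ {b}) with hS
  have hup := levelGE_anti (G := G) (u₀ := u₀) (u₁ := u₁) (show i + 2 ≤ i + 3 by omega)
  have hSlev : S ⊆ levelGE G u₀ u₁ (i + 2) := by
    rintro v (hv | hv | rfl)
    · exact hup (componentIn_subset hv)
    · exact level_subset_levelGE le_rfl (levelComponent_subset ha hv)
    · exact level_subset_levelGE le_rfl hb
  have haS : a ∈ S := Or.inr (Or.inl (mem_levelComponent_self ha))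
  have hbS : b ∈ S := Or.inr (Or.inr rfl)
  have hconn : b ∈ componentIn (unboxed G u₀ u₁) S a := by
    have h1 : ea ∈ componentIn (unboxed G u₀ u₁) S a :=
      componentIn_step (mem_componentIn_self haS)
        (unboxed_adj_of_reachable ha.1 (componentIn_subset hea).1 hae) (Or.inl hea)
    have h2 : eb ∈ componentIn (unboxed G u₀ u₁) S a := by
      have hr : eb ∈ region G u₀ u₁ (i + 3) ea := componentIn_trans (componentIn_symm hea) heb
      have hsub : region G u₀ u₁ (i + 3) r ⊆ S := Set.subset_union_left
      have h3 : ∀ w ∈ region G u₀ u₁ (i + 3) ea, w ∈ region G u₀ u₁ (i + 3) r ∧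
          w ∈ componentIn (unboxed G u₀ u₁) S a :=
        componentIn_induction ⟨hea, h1⟩ fun y hy z hz hP hyz =>
          have hz' := componentIn_step hP.1 hyz hz
          ⟨hz', componentIn_step hP.2 hyz (hsub hz')⟩
      exact (h3 _ hr).2
    exact componentIn_step h2
      (unboxed_adj_of_reachable (componentIn_subset heb).1 hb.1 hbe.symm) hbS
  obtain ⟨n, f, hf0, hfn, hfS, hf, hfA, hfB⟩ :=
    exists_indPath_between (A := levelComponent G u₀ u₁ a) (B := {b})
      (mem_levelComponent_self ha) rfl hconn
  replace hfn : f n = b := hfn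
  replace hf := hf.of_unboxed fun k hk => hSlev (hfS k hk)
  have hf0l := levelComponent_subset ha hf0
  have hint : ∀ k, 0 < k → k < n → f k ∈ region G u₀ u₁ (i + 3) r := by
    intro k h0 hk
    rcases hfS k hk.le with h | h | h
    exacts [h, absurd h (hfA k h0 hk.le), absurd h (hfB k hk)]
  have hn0 : 0 < n := by
    rcases Nat.eq_zero_or_pos n with rfl | h
    exacts [absurd (hfn ▸ hf0) hba, h]
  have h0b : ¬ G.Adj (f 0) b := fun h => hba (mem_levelComponent_of_adj ha hf0 hb h)
  have h0b' : f 0 ≠ b := fun h => hba (h ▸ hf0)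
  have hn1 : 1 < n := by
    by_contra hcon
    obtain rfl : n = 1 := by omega
    exact h0b (hfn ▸ hf.adj_succ hn0)
  refine ⟨n, f, hn1, ?_, hf, hf0, hfn, hint⟩
  obtain ⟨p, hp, hp0⟩ := exists_parent hf0l
  obtain ⟨q, hq, hqb⟩ := exists_parent hb
  have hlow : ∀ q ∈ level G u₀ u₁ (i + 1), ∀ k, 0 < k → k < n → ¬ G.Adj q (f k) :=
    fun q hq k h0 hk => not_adj_of_level hq (componentIn_subset (hint k h0 hk)) (by omega)
  refine even_of_indPath hclaw heven hp hq ?_ hf (fun k hk => hSlev (hfS k hk)) hp0.symm ?_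
    (by rw [hfn]; exact hqb.symm) ?_
  · rintro rfl
    exact h0b (adj_of_common_parent hclaw hp hf0l hb hp0.symm hqb.symm h0b')
  · intro k h0 hk
    rcases hk.eq_or_lt with rfl | hk
    · rw [hfn]
      exact fun h => h0b (adj_of_common_parent hclaw hp hf0l hb hp0.symm h h0b')
    · exact hlow p hp k h0 hk
  · intro k hk
    rcases Nat.eq_zero_or_pos k with rfl | h0
    · exact fun h => h0b (adj_of_common_parent hclaw hq hf0l hb h hqb.symm h0b')
    · exact hlow q hq k h0 hk

/-- A parent of `z` that misses `b` would be a private parent for the even path from the component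
of `a` to `b` prolonged by `z`, a path of odd length. It is induced because `z` is not attached to
the region. -/
theorem attached_parents_subset (hclaw : ClawFree G) (heven : EvenHoleFree G) {a b : V}
    (ha : a ∈ level G u₀ u₁ (i + 2)) (hb : b ∈ level G u₀ u₁ (i + 2))
    (hab : a ∉ levelComponent G u₀ u₁ b) (hra : Attached G u₀ u₁ (i + 3) r a)
    (hrb : Attached G u₀ u₁ (i + 3) r b) (hz : z ∈ level G u₀ u₁ (i + 2)) (hbz : G.Adj b z)
    (hrz : ¬ Attached G u₀ u₁ (i + 3) r z) (hq : q ∈ level G u₀ u₁ (i + 1))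
    (hqz : G.Adj q z) : G.Adj q b := by
  by_contra hqb
  obtain ⟨n, f, hn1, hn, hf, hf0, rfl, hint⟩ := exists_even_path hclaw heven ha hb hab hra hrb
  have hf0l := levelComponent_subset ha hf0
  have hza : z ∉ levelComponent G u₀ u₁ a := fun h =>
    hab (mem_levelComponent_comm ha (mem_levelComponent_of_adj ha h hb hbz.symm))
  have hba : f n ∉ levelComponent G u₀ u₁ a := fun h => hab (mem_levelComponent_comm ha h)
  have h0z : ¬ G.Adj (f 0) z := fun h => hza (mem_levelComponent_of_adj ha hf0 hz h)
  have h0z' : f 0 ≠ z := by rintro rfl; exact hza hf0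
  have h0b : ¬ G.Adj (f 0) (f n) := fun h => hba (mem_levelComponent_of_adj ha hf0 hb h)
  have h0b' : f 0 ≠ f n := fun h => hba (h ▸ hf0)
  obtain ⟨p, hp, hp0⟩ := exists_parent hf0l
  have hpn : ¬ G.Adj p (f n) := fun h =>
    h0b (adj_of_common_parent hclaw hp hf0l hb hp0.symm h h0b')
  have hpz : ¬ G.Adj p z := fun h =>
    h0z (adj_of_common_parent hclaw hp hf0l hz hp0.symm h h0z')
  have hq0 : ¬ G.Adj q (f 0) := fun h =>
    h0z (adj_of_common_parent hclaw hq hf0l hz h hqz h0z')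
  have hlow : ∀ q ∈ level G u₀ u₁ (i + 1), ∀ k, 0 < k → k < n → ¬ G.Adj q (f k) :=
    fun q hq k h0 hk => not_adj_of_level hq (componentIn_subset (hint k h0 hk)) (by omega)
  have hval : ∀ k ≤ n, joinSeq f n (fun _ => z) k = f k := fun k hk => joinSeq_left hk
  have hval' : joinSeq f n (fun _ => z) (n + 0 + 1) = z := joinSeq_right (by omega)
  have := even_of_indPath hclaw heven (f := joinSeq f n (fun _ => z)) (n := n + 0 + 1) hp hq
    (by rintro rfl; exact hpz hqz) (hf.join (indPath_const z) ?_) ?_ ?_ ?_ (by rwa [hval']) ?_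
  · rw [add_zero, Nat.even_add_one] at this
    exact this hn
  · intro k hk b' hb'
    obtain rfl : b' = 0 := by omega
    rcases hk.eq_or_lt with rfl | hk
    · exact ⟨hbz.ne, iff_of_true hbz ⟨rfl, rfl⟩⟩
    rcases Nat.eq_zero_or_pos k with rfl | h0
    · exact ⟨h0z', iff_of_false h0z (by omega)⟩
    · refine ⟨(ne_of_level hz (componentIn_subset (hint k h0 hk)) (by omega)).symm, ?_⟩
      exact iff_of_false (fun h => hrz ⟨_, hint k h0 hk, h.symm⟩) (by omega)
  · intro k hk
    rcases (show k ≤ n + 1 by omega).eq_or_lt with rfl | hk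
    · rw [show n + 1 = n + 0 + 1 by omega, hval']
      exact level_subset_levelGE le_rfl hz
    rw [hval k (by omega)]
    rcases (show k ≤ n by omega).eq_or_lt with rfl | hk
    · exact level_subset_levelGE le_rfl hb
    rcases Nat.eq_zero_or_pos k with rfl | h0
    · exact level_subset_levelGE le_rfl hf0l
    · exact levelGE_anti (by omega) (componentIn_subset (hint k h0 hk))
  · rw [hval 0 (by omega)]
    exact hp0.symm
  · intro k h0 hk
    rcases (show k ≤ n + 1 by omega).eq_or_lt with rfl | hk
    · rwa [show n + 1 = n + 0 + 1 by omega, hval']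
    rw [hval k (by omega)]
    rcases (show k ≤ n by omega).eq_or_lt with rfl | hk
    exacts [hpn, hlow p hp k h0 hk]
  · intro k hk
    rw [hval k (by omega)]
    rcases (show k ≤ n by omega).eq_or_lt with rfl | hk
    · exact hqb
    rcases Nat.eq_zero_or_pos k with rfl | h0
    exacts [hq0, hlow q hq k h0 hk]

/-- Two children of `b` are equal or adjacent, so they lie in the same region. -/
theorem not_attached_of_attached (hclaw : ClawFree G) {r' b : V}
    (hb : b ∈ level G u₀ u₁ i) (hrr : r' ∉ region G u₀ u₁ (i + 1) r)
    (hrb : Attached G u₀ u₁ (i + 1) r b) : ¬ Attached G u₀ u₁ (i + 1) r' b := by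
  rintro ⟨e', he', hbe'⟩
  obtain ⟨e, he, hbe⟩ := hrb
  refine hrr (componentIn_trans ?_ (componentIn_symm he'))
  by_cases h : e = e'
  · exact h ▸ he
  · exact region_step he (componentIn_subset he') (adj_of_common_parent hclaw hb
      (mem_level_of_adj hb (componentIn_subset he) hbe)
      (mem_level_of_adj hb (componentIn_subset he') hbe') hbe hbe' h)

/-- Two even paths, one through each region, are connected by the edge `bb'`. The resulting induced
path is odd and has private parents at its ends. -/
theorem not_chain_of_adj (hclaw : ClawFree G) (heven : EvenHoleFree G) {r' a b b' e : V}
    (ha : a ∈ level G u₀ u₁ (i + 2)) (hb : b ∈ level G u₀ u₁ (i + 2))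
    (he : e ∈ level G u₀ u₁ (i + 2)) (hb' : b' ∈ levelComponent G u₀ u₁ b)
    (hab : a ∉ levelComponent G u₀ u₁ b) (heb : e ∉ levelComponent G u₀ u₁ b)
    (hea : e ∉ levelComponent G u₀ u₁ a) (hrr : r' ∉ region G u₀ u₁ (i + 3) r)
    (hra : Attached G u₀ u₁ (i + 3) r a) (hrb : Attached G u₀ u₁ (i + 3) r b)
    (hrb' : Attached G u₀ u₁ (i + 3) r' b') (hre : Attached G u₀ u₁ (i + 3) r' e)
    (hadj : G.Adj b b') : False := by
  have hrr' : r ∉ region G u₀ u₁ (i + 3) r' := fun h => hrr (componentIn_symm h)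
  have hb'l := levelComponent_subset hb hb'
  have hcomp := levelComponent_eq hb hb'
  have heb' : e ∉ levelComponent G u₀ u₁ b' := by rwa [hcomp]
  obtain ⟨n, f, hn1, hn, hf, hf0, rfl, hint⟩ := exists_even_path hclaw heven ha hb hab hra hrb
  obtain ⟨m, g, hm1, hm, hg, hg0, rfl, hint'⟩ :=
    exists_even_path hclaw heven he hb'l heb' hre hrb'
  have hf0l := levelComponent_subset ha hf0
  have hg0l := levelComponent_subset he hg0
  have hfr : ∀ k ≤ n, ∀ w ∈ region G u₀ u₁ (i + 3) r', f k ≠ w ∧ ¬ G.Adj (f k) w := by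
    have hcase : ∀ k ≤ n, f k ∈ level G u₀ u₁ (i + 2) → Attached G u₀ u₁ (i + 3) r (f k) →
        ∀ w ∈ region G u₀ u₁ (i + 3) r', f k ≠ w ∧ ¬ G.Adj (f k) w := fun k _ hl hat w hw =>
      ⟨ne_of_level hl (componentIn_subset hw) (by omega),
        fun h => not_attached_of_attached hclaw hl hrr hat ⟨w, hw, h⟩⟩
    intro k hk w hw
    rcases hk.eq_or_lt with rfl | hk
    · exact hcase _ le_rfl hb hrb w hw
    rcases Nat.eq_zero_or_pos k with rfl | h0
    · exact hcase _ hk.le hf0l ⟨_, hint 1 one_pos hn1, hf.adj_succ hk⟩ w hw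
    · refine ⟨?_, fun h => ?_⟩
      · rintro rfl
        exact hrr (componentIn_trans (hint k h0 hk) (componentIn_symm hw))
      · exact hrr (componentIn_trans
          (region_step (hint k h0 hk) (componentIn_subset hw) h) (componentIn_symm hw))
  have hgr : ∀ k ≤ m, g k ∈ level G u₀ u₁ (i + 2) → Attached G u₀ u₁ (i + 3) r' (g k) →
      ∀ w ∈ region G u₀ u₁ (i + 3) r, w ≠ g k ∧ ¬ G.Adj w (g k) := fun k _ hl hat w hw =>
    ⟨(ne_of_level hl (componentIn_subset hw) (by omega)).symm,
      fun h => not_attached_of_attached hclaw hl hrr' hat ⟨w, hw, h.symm⟩⟩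
  have hlowf : ∀ q ∈ level G u₀ u₁ (i + 1), ∀ k, 0 < k → k < n → ¬ G.Adj q (f k) :=
    fun q hq k h0 hk => not_adj_of_level hq (componentIn_subset (hint k h0 hk)) (by omega)
  have hlowg : ∀ q ∈ level G u₀ u₁ (i + 1), ∀ k, 0 < k → k < m → ¬ G.Adj q (g k) :=
    fun q hq k h0 hk => not_adj_of_level hq (componentIn_subset (hint' k h0 hk)) (by omega)
  have hdiff : ∀ {v w}, v ∈ levelComponent G u₀ u₁ a → w ∈ level G u₀ u₁ (i + 2) →
      w ∉ levelComponent G u₀ u₁ a → v ≠ w ∧ ¬ G.Adj v w := by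
    intro v w hv hw hwa
    refine ⟨?_, fun h => hwa (mem_levelComponent_of_adj ha hv hw h)⟩
    rintro rfl
    exact hwa hv
  have hdiff' : ∀ {v w}, v ∈ levelComponent G u₀ u₁ e → w ∈ level G u₀ u₁ (i + 2) →
      w ∉ levelComponent G u₀ u₁ e → v ≠ w ∧ ¬ G.Adj v w := by
    intro v w hv hw hwa
    refine ⟨?_, fun h => hwa (mem_levelComponent_of_adj he hv hw h)⟩
    rintro rfl
    exact hwa hv
  have hnp : ∀ {v w q}, v ∈ level G u₀ u₁ (i + 2) → w ∈ level G u₀ u₁ (i + 2) →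
      q ∈ level G u₀ u₁ (i + 1) → (v ≠ w ∧ ¬ G.Adj v w) → G.Adj q v → ¬ G.Adj q w :=
    fun hv hw hq h hqv hqw => h.2 (adj_of_common_parent hclaw hq hv hw hqv hqw h.1)
  have h1 := hdiff hf0 hb fun h => hab (mem_levelComponent_comm ha h)
  have h2 := hdiff hf0 hb'l fun h => hab (by
    rw [← hcomp]; exact mem_levelComponent_comm ha h)
  have h3 := hdiff hf0 hg0l fun h => hea (by
    rw [← levelComponent_eq ha h]; exact mem_levelComponent_comm he hg0)
  have h4 := hdiff' hg0 hb fun h => heb (mem_levelComponent_comm he h)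
  have h5 := hdiff' hg0 hb'l fun h => heb' (mem_levelComponent_comm he h)
  obtain ⟨p, hp, hp0⟩ := exists_parent hf0l
  obtain ⟨q, hq, hq0⟩ := exists_parent hg0l
  have hodd := even_of_indPath hclaw heven (f := joinSeq f n fun k => g (m - k))
    (n := n + m + 1) hp hq ?_ (hf.join hg.reverse ?_) ?_ ?_ ?_ ?_ ?_
  · rw [Nat.even_add_one] at hodd
    exact hodd (hn.add hm)
  · rintro rfl
    exact hnp hf0l hg0l hp h3 hp0.symm hq0.symm
  · intro k hk l hl
    by_cases hml : 0 < m - l ∧ m - l < m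
    · have := hfr k hk _ (hint' (m - l) hml.1 hml.2)
      exact ⟨this.1, iff_of_false this.2 (by omega)⟩
    have hgl : g (m - l) ∈ level G u₀ u₁ (i + 2) ∧ Attached G u₀ u₁ (i + 3) r' (g (m - l)) := by
      rcases (show m - l = 0 ∨ m - l = m by omega) with h | h <;> rw [h]
      · exact ⟨hg0l, _, hint' 1 one_pos hm1, hg.adj_succ (by omega)⟩
      · exact ⟨hb'l, hrb'⟩
    by_cases hkn : 0 < k ∧ k < n
    · have := hgr (m - l) (by omega) hgl.1 hgl.2 _ (hint k hkn.1 hkn.2)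
      exact ⟨this.1, iff_of_false this.2 (by omega)⟩
    rcases (show k = 0 ∨ k = n by omega) with rfl | rfl
    · rcases (show m - l = 0 ∨ m - l = m by omega) with h | h <;> simp only [h]
      exacts [⟨h3.1, iff_of_false h3.2 (by omega)⟩, ⟨h2.1, iff_of_false h2.2 (by omega)⟩]
    · rcases (show m - l = 0 ∨ m - l = m by omega) with h | h <;> simp only [h]
      · exact ⟨h4.1.symm, iff_of_false (fun h => h4.2 h.symm) (by omega)⟩
      · exact ⟨hadj.ne, iff_of_true hadj ⟨trivial, by omega⟩⟩
  · intro k hk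
    rcases le_or_gt k n with hkn | hkn
    · rw [joinSeq_left hkn]
      rcases hkn.eq_or_lt with rfl | hk
      · exact level_subset_levelGE le_rfl hb
      rcases Nat.eq_zero_or_pos k with rfl | h0
      · exact level_subset_levelGE le_rfl hf0l
      · exact levelGE_anti (by omega) (componentIn_subset (hint k h0 hk))
    · rw [joinSeq_right hkn]
      rcases (show m - (k - (n + 1)) ≤ m by omega).eq_or_lt with h | hk
      · simp only [h]
        exact level_subset_levelGE le_rfl hb'l
      rcases Nat.eq_zero_or_pos (m - (k - (n + 1))) with h | h0
      · simp only [h]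
        exact level_subset_levelGE le_rfl hg0l
      · exact levelGE_anti (by omega) (componentIn_subset (hint' _ h0 hk))
  · rw [joinSeq_left (by omega)]
    exact hp0.symm
  · intro k h0 hk
    rcases le_or_gt k n with hkn | hkn
    · rw [joinSeq_left hkn]
      rcases hkn.eq_or_lt with rfl | hk
      exacts [hnp hf0l hb hp h1 hp0.symm, hlowf p hp k h0 hk]
    · rw [joinSeq_right hkn]
      rcases (show m - (k - (n + 1)) ≤ m by omega).eq_or_lt with h | hk
      · simp only [h]
        exact hnp hf0l hb'l hp h2 hp0.symm
      rcases Nat.eq_zero_or_pos (m - (k - (n + 1))) with h | h0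
      · simp only [h]
        exact hnp hf0l hg0l hp h3 hp0.symm
      · exact hlowg p hp _ h0 hk
  · rw [joinSeq_right (by omega), show m - (n + m + 1 - (n + 1)) = 0 by omega]
    exact hq0.symm
  · intro k hk
    rcases le_or_gt k n with hkn | hkn
    · rw [joinSeq_left hkn]
      rcases hkn.eq_or_lt with rfl | hk
      · exact hnp hg0l hb hq h4 hq0.symm
      rcases Nat.eq_zero_or_pos k with rfl | h0
      exacts [hnp hg0l hf0l hq ⟨h3.1.symm, fun h => h3.2 h.symm⟩ hq0.symm, hlowf q hq k h0 hk]
    · rw [joinSeq_right hkn]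
      rcases (show m - (k - (n + 1)) ≤ m by omega).eq_or_lt with h | hk
      · simp only [h]
        exact hnp hg0l hb'l hq h5 hq0.symm
      · exact hlowg q hq _ (by omega) hk

/-- A component attached to two regions that lead to two further components does not exist. -/
theorem not_chain [Finite V] (hclaw : ClawFree G) (heven : EvenHoleFree G) {r' a b b' e : V}
    (ha : a ∈ level G u₀ u₁ (i + 2)) (hb : b ∈ level G u₀ u₁ (i + 2))
    (he : e ∈ level G u₀ u₁ (i + 2)) (hb' : b' ∈ levelComponent G u₀ u₁ b)
    (hab : a ∉ levelComponent G u₀ u₁ b) (heb : e ∉ levelComponent G u₀ u₁ b)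
    (hea : e ∉ levelComponent G u₀ u₁ a) (hrr : r' ∉ region G u₀ u₁ (i + 3) r)
    (hra : Attached G u₀ u₁ (i + 3) r a) (hrb : Attached G u₀ u₁ (i + 3) r b)
    (hrb' : Attached G u₀ u₁ (i + 3) r' b') (hre : Attached G u₀ u₁ (i + 3) r' e) : False := by
  have hb'l := levelComponent_subset hb hb'
  have hcomp := levelComponent_eq hb hb'
  by_cases hadj : G.Adj b b'
  · exact not_chain_of_adj hclaw heven ha hb he hb' hab heb hea hrr hra hrb hrb' hre hadj
  have hbb' : b ≠ b' := by
    rintro rfl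
    exact not_attached_of_attached hclaw hb hrr hrb hrb'
  obtain ⟨d, hd, -⟩ := exists_dominating_king hclaw heven hb
  have hdl := levelComponent_subset hb hd.1
  have hdcomp := levelComponent_eq hb hd.1
  have hdb : d ≠ b := by
    rintro rfl
    exact hadj (hd.2 b' hb' hbb'.symm)
  have hdb' : d ≠ b' := by
    rintro rfl
    exact hadj (hd.2 b (mem_levelComponent_self hb) hbb').symm
  have h1 := hd.2 b (mem_levelComponent_self hb) hdb.symm
  have h2 := hd.2 b' hb' hdb'.symm
  -- If the king `d` were attached to one of the regions, it could replace `b` or `b'` in the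
  -- adjacent case. Being attached to neither, it passes its parents on to both `b` and `b'`, which
  -- are then adjacent after all.
  have hrd : ¬ Attached G u₀ u₁ (i + 3) r d := fun h =>
    not_chain_of_adj hclaw heven ha hdl he (by rwa [hdcomp]) (by rwa [hdcomp]) (by rwa [hdcomp])
      hea hrr hra h hrb' hre h2
  have hrd' : ¬ Attached G u₀ u₁ (i + 3) r' d := fun h =>
    not_chain_of_adj hclaw heven ha hb he hd.1 hab heb hea hrr hra hrb h hre h1.symm
  obtain ⟨q, hq, hqd⟩ := exists_parent hdl
  exact hadj (adj_of_common_parent hclaw hq hb hb'l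
    (attached_parents_subset hclaw heven ha hb hab hra hrb hdl h1.symm hrd hq hqd.symm)
    (attached_parents_subset hclaw heven he hb'l (by rwa [hcomp]) hre hrb' hdl h2.symm hrd' hq
      hqd.symm) hbb')

theorem mateUnique_of_le_one (hj : j ≤ 1) : MateUnique G u₀ u₁ j := by
  intro x hx y hy z hz _ _
  have : x = y := by
    rcases (show j = 0 ∨ j = 1 by omega) with rfl | rfl
    · rw [eq_of_mem_level_zero hx, eq_of_mem_level_zero hy]
    · rw [eq_of_mem_level_one hx, eq_of_mem_level_one hy]
  exact Or.inl (this ▸ mem_levelComponent_self hx)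

/-- A set of vertices of a level that is closed under passing through one region contains all
linked vertices. -/
theorem region_level_subset {P : V → Prop} (hx : x ∈ level G u₀ u₁ j) (hPx : P x)
    (hcomp : ∀ y ∈ level G u₀ u₁ j, ∀ z ∈ levelComponent G u₀ u₁ y, P y → P z)
    (hreg : ∀ r ∈ levelGE G u₀ u₁ (j + 1), ∀ y ∈ level G u₀ u₁ j, ∀ z ∈ level G u₀ u₁ j,
      Attached G u₀ u₁ (j + 1) r y → Attached G u₀ u₁ (j + 1) r z → P y → P z) :
    ∀ y ∈ region G u₀ u₁ j x, y ∈ level G u₀ u₁ j → P y := by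
  have key : ∀ y ∈ region G u₀ u₁ j x, (y ∈ level G u₀ u₁ j → P y) ∧
      (y ∈ levelGE G u₀ u₁ (j + 1) →
        ∃ z ∈ level G u₀ u₁ j, Attached G u₀ u₁ (j + 1) y z ∧ P z) := by
    refine componentIn_induction
      ⟨fun _ => hPx, fun h => absurd h (notMem_levelGE_of_mem_level hx (by omega))⟩ ?_
    rintro y hy z hz ⟨h1, h2⟩ hyz
    rcases mem_level_or_of_mem_levelGE hy with hyl | hyl
    · refine ⟨fun hzl => hcomp y hyl z ?_ (h1 hyl), fun hzl => ⟨y, hyl, ?_, h1 hyl⟩⟩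
      · exact mem_levelComponent_of_adj hyl (mem_levelComponent_self hyl) hzl hyz.1
      · exact ⟨z, mem_componentIn_self hzl, hyz.1⟩
    · obtain ⟨w, hw, ⟨v, hv, hwv⟩, hPw⟩ := h2 hyl
      refine ⟨fun hzl => hreg y hyl w hw z hzl ⟨v, hv, hwv⟩
        ⟨y, mem_componentIn_self hyl, hyz.1.symm⟩ hPw, fun hzl => ⟨w, hw, ⟨v, ?_, hwv⟩, hPw⟩⟩
      exact componentIn_trans (componentIn_symm
        (region_step (mem_componentIn_self hyl) hzl hyz.1)) hv
  exact fun y hy => (key y hy).1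

/-- One region already joins the component of `x` to a second one. A third component could be
reached through that same region, against `MateUnique.attached`, or through a different region,
against `not_chain`. -/
theorem mateUnique_step [Finite V] (hclaw : ClawFree G) (heven : EvenHoleFree G)
    (hM : MateUnique G u₀ u₁ (i + 3)) : MateUnique G u₀ u₁ (i + 2) := by
  intro x hx y hy z hz hxy hxz
  by_contra! hcon
  obtain ⟨hyx, hzx, hzy⟩ := hcon
  obtain ⟨r, hr, x', hx', w, hw, hrx, hrw, hwx⟩ : ∃ r ∈ levelGE G u₀ u₁ (i + 3),
      ∃ x' ∈ levelComponent G u₀ u₁ x, ∃ w ∈ level G u₀ u₁ (i + 2),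
        Attached G u₀ u₁ (i + 3) r x' ∧ Attached G u₀ u₁ (i + 3) r w ∧
        w ∉ levelComponent G u₀ u₁ x := by
    -- If no region led out of the component of `x`, everything linked to `x` would stay inside it,
    -- including `y`.
    by_contra! hno
    refine hyx (region_level_subset (P := (· ∈ levelComponent G u₀ u₁ x)) hx
      (mem_levelComponent_self hx) ?_ ?_ y hxy hy)
    · intro a ha b hb hax
      rwa [levelComponent_eq hx hax] at hb
    · exact fun r hr a ha b hb hra hrb hax => hno r hr a hax b hb hra hrb
  have hx'l := levelComponent_subset hx hx'
  have hx'c := levelComponent_eq hx hx'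
  have hwx' : w ∉ levelComponent G u₀ u₁ x' := by rwa [hx'c]
  have hall : ∀ v ∈ region G u₀ u₁ (i + 2) x, v ∈ level G u₀ u₁ (i + 2) →
      v ∈ levelComponent G u₀ u₁ x' ∨ v ∈ levelComponent G u₀ u₁ w := by
    refine region_level_subset hx (Or.inl (mem_levelComponent_comm hx hx')) ?_ ?_
    · rintro a ha b hb (h | h)
      · exact Or.inl (levelComponent_eq hx'l h ▸ hb)
      · exact Or.inr (levelComponent_eq hw h ▸ hb)
    · intro r' hr' a ha b hb hra hrb hab
      by_contra! hb'
      by_cases hrr : r' ∈ region G u₀ u₁ (i + 3) r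
      · have hrb' : Attached G u₀ u₁ (i + 3) r b := by
          obtain ⟨v, hv, hbv⟩ := hrb
          exact ⟨v, componentIn_trans hrr hv, hbv⟩
        rcases hM.attached hclaw heven hx'l hw hb hrx hrw hrb' with h | h | h
        exacts [hwx' h, hb'.1 h, hb'.2 h]
      · rcases hab with h | h
        · exact not_chain hclaw heven hw hx'l hb h hwx' hb'.1 hb'.2 hrr hrw hrx hra hrb
        · exact not_chain hclaw heven hx'l hw hb h
            (fun h => hwx' (mem_levelComponent_comm hw h)) hb'.2 hb'.1 hrr hrx hrw hra hrb
  rw [hx'c] at hall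
  have hyw := (hall y hxy hy).resolve_left hyx
  have hzw := (hall z hxz hz).resolve_left hzx
  rw [levelComponent_eq hw hyw] at hzy
  exact hzy hzw

theorem level_eq_empty [Finite V] (hj : Nat.card V ≤ j) : level G u₀ u₁ j = ∅ := by
  have := Fintype.ofFinite V
  rw [Set.eq_empty_iff_forall_notMem]
  rintro x hx
  obtain ⟨w, hw, hlen⟩ := hx.1.exists_path_of_dist
  have h1 := hw.length_lt
  have h2 : (unboxed G u₀ u₁).dist u₀ x = j := hx.2
  rw [← Nat.card_eq_fintype_card] at h1
  omega

theorem mateUnique [Finite V] (hclaw : ClawFree G) (heven : EvenHoleFree G) (j : ℕ) :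
    MateUnique G u₀ u₁ j := by
  -- The induction runs downwards from the empty levels; `k` bounds the distance of `j` from
  -- `Nat.card V`.
  suffices h : ∀ k j, Nat.card V ≤ j + k → MateUnique G u₀ u₁ j from h (Nat.card V) j (by omega)
  intro k
  induction k with
  | zero =>
    intro j hj x hx
    rw [level_eq_empty (by simpa using hj)] at hx
    exact hx.elim
  | succ k ih =>
    intro j hj
    rcases (show j ≤ 1 ∨ ∃ i, j = i + 2 from by
      rcases le_or_gt j 1 with h | h
      exacts [Or.inl h, Or.inr ⟨j - 2, by omega⟩]) with h | ⟨i, rfl⟩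
    · exact mateUnique_of_le_one h
    · exact mateUnique_step hclaw heven (ih _ (by omega))

end Mates

end CopsRobber

namespace CopsRobber

/-! ### Simple paths climb one level at a time -/

section SimplePaths

variable {V : Type*} {G : SimpleGraph V} {u₀ u₁ x y z p q r a b d m e v : V} {i j : ℕ}

theorem gate_mem_level (hu : G.Adj u₀ u₁) : u₁ ∈ level G u₀ u₁ 1 := by
  have h : (unboxed G u₀ u₁).Adj u₀ u₁ := ⟨hu, fun h => G.irrefl h.1, fun h => h.2 rfl⟩
  exact ⟨⟨.cons h .nil⟩, SimpleGraph.dist_eq_one_iff_adj.2 h⟩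

/-- Depth changes by at most one along an edge and never repeats, so once the path climbs it must go
on climbing. -/
theorem depth_getVert_of_isSimplePath (hu : G.Adj u₀ u₁) {w : (unboxed G u₀ u₁).Walk u₁ r}
    (hw : IsSimplePath G u₀ u₁ w) (hr : r ≠ u₀) :
    ∀ k ≤ w.length, w.getVert k ∈ level G u₀ u₁ (k + 1) := by
  have hinj : ∀ k ≤ w.length, ∀ l ≤ w.length, w.getVert k = w.getVert l → k = l :=
    fun k hk l hl h => hw.1.getVert_injOn hk hl h
  have hreach : ∀ k, (unboxed G u₀ u₁).Reachable u₀ (w.getVert k) := fun k =>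
    (gate_mem_level hu).1.trans ⟨w.take k⟩
  intro k
  induction k using Nat.strong_induction_on with
  | _ k ih =>
    intro hk
    rcases k with _ | k
    · rw [w.getVert_zero]; exact gate_mem_level hu
    have hx := ih k (by omega) (by omega)
    have hadj := w.adj_getVert_succ (show k < w.length by omega)
    have h1 := depth_le_succ hx.1 hadj
    have h2 := depth_le_succ (hreach (k + 1)) hadj.symm
    rw [hx.2] at h1 h2
    have h3 : depth G u₀ u₁ (w.getVert (k + 1)) ≠ k + 1 := by
      intro h
      have := hinj _ hk _ (by omega) (hw.2 _ (w.getVert_mem_support _) _ (w.getVert_mem_support _)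
        (h.trans hx.2.symm))
      omega
    have h4 : depth G u₀ u₁ (w.getVert (k + 1)) ≠ k := by
      intro h
      -- A descent at the very start leads to `u₀`, whose only neighbour outside the box is `u₁`:
      -- the path would have to end at `u₀`, which `hr` excludes, or return to its start.
      rcases k with _ | k
      · have h0 : w.getVert 1 = u₀ := eq_of_mem_level_zero ⟨hreach 1, h⟩
        have hlen : 1 < w.length := by
          by_contra hcon
          refine hr (Eq.trans ?_ h0)
          rw [show 1 = w.length by omega, w.getVert_length]
        have hadj' := w.adj_getVert_succ hlen
        rw [h0] at hadj'
        have h5 : w.getVert 2 = u₁ := by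
          by_contra hne
          exact hadj'.2.2 ⟨hadj'.1, hne⟩
        have := hinj 2 (by omega) 0 (by omega) (by rw [h5, w.getVert_zero])
        omega
      · have := hinj _ hk k (by omega) (hw.2 _ (w.getVert_mem_support _) _
          (w.getVert_mem_support _) (h.trans (ih k (by omega) (by omega)).2.symm))
        omega
    exact ⟨hreach _, by omega⟩

/-- After its step into level `i + 1` the path never comes down again, so the rest of it links `d`
to the robber inside the upper levels. -/
theorem IsNextComponent.exists_vertex (hu : G.Adj u₀ u₁) {P : Set V}
    (ha : a ∈ level G u₀ u₁ i) (hr : r ∈ levelGE G u₀ u₁ (i + 1))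
    (h : IsNextComponent G u₀ u₁ r (levelComponent G u₀ u₁ a) P) :
    ∃ d ∈ level G u₀ u₁ (i + 1), d ∈ region G u₀ u₁ (i + 1) r ∧
      P = levelComponent G u₀ u₁ d ∧ ∃ x ∈ levelComponent G u₀ u₁ a, G.Adj x d := by
  obtain ⟨w, hw, t, ht, hta, rfl⟩ := h
  have hr0 : r ≠ u₀ := by
    rintro rfl
    have h1 := hr.2
    simp [depth] at h1
  have hdepth := depth_getVert_of_isSimplePath hu hw hr0
  obtain ⟨k, hk, hkt⟩ := List.mem_iff_getElem.1 ht
  have hlen : k < w.length := by simpa using hk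
  have hfst : t.fst = w.getVert k := by
    rw [← hkt]
    simp [SimpleGraph.Walk.support_getElem_eq_getVert]
  have hsnd : t.snd = w.getVert (k + 1) := by
    rw [← hkt]
    simp [SimpleGraph.Walk.support_getElem_eq_getVert]
  have hki : k + 1 = i := eq_of_mem_level (hfst ▸ hdepth k hlen.le) (levelComponent_subset ha hta)
  subst hki
  refine ⟨t.snd, hsnd ▸ hdepth (k + 1) hlen, ?_, rfl, t.fst, hta, t.adj.1⟩
  rw [hsnd]
  have hcomp : ∀ l, k + 1 ≤ l → l ≤ w.length →
      w.getVert l ∈ region G u₀ u₁ (k + 1 + 1) (w.getVert (k + 1)) := by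
    intro l hl
    induction l, hl using Nat.le_induction with
    | base => exact fun h => mem_componentIn_self (level_subset_levelGE le_rfl (hdepth _ h))
    | succ l hl ih =>
      intro h
      exact componentIn_step (ih (by omega)) (w.adj_getVert_succ (by omega))
        (level_subset_levelGE (by omega) (hdepth _ h))
  have := hcomp w.length hlen le_rfl
  rw [w.getVert_length] at this
  exact componentIn_symm this

/-- Distinctness of the depths along a walk encodes both parts of `IsSimplePath` at once, and the
depth bound lets it survive the appended vertex. -/
theorem depth_nodup_concat {n : ℕ} (hx : x ∈ level G u₀ u₁ (n + 1))
    (hyx : (unboxed G u₀ u₁).Adj y x) {w : (unboxed G u₀ u₁).Walk u₁ y}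
    (hw : (w.support.map (depth G u₀ u₁)).Nodup) (hle : ∀ z ∈ w.support, depth G u₀ u₁ z ≤ n) :
    ((w.concat hyx).support.map (depth G u₀ u₁)).Nodup ∧
      ∀ z ∈ (w.concat hyx).support, depth G u₀ u₁ z ≤ n + 1 := by
  refine ⟨?_, fun z hz => ?_⟩
  · rw [SimpleGraph.Walk.support_concat, List.map_append, List.nodup_append]
    refine ⟨hw, by simp, ?_⟩
    simp only [List.mem_map, List.map_cons, List.map_nil, List.mem_singleton, hx.2]
    rintro _ ⟨z, hz, rfl⟩ _ rfl
    have := hle z hz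
    omega
  · rw [SimpleGraph.Walk.support_concat, List.mem_append] at hz
    rcases hz with hz | hz
    · have := hle z hz
      omega
    · simp only [List.mem_singleton] at hz
      rw [hz, hx.2]

theorem exists_simple_walk (hu : G.Adj u₀ u₁) (i : ℕ) :
    ∀ x ∈ level G u₀ u₁ (i + 1), ∃ w : (unboxed G u₀ u₁).Walk u₁ x,
      (w.support.map (depth G u₀ u₁)).Nodup ∧ ∀ z ∈ w.support, depth G u₀ u₁ z ≤ i + 1 := by
  induction i with
  | zero =>
    intro x hx
    obtain rfl := eq_of_mem_level_one hx
    refine ⟨.nil, by simp, ?_⟩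
    simp [hx.2]
  | succ i ih =>
    intro x hx
    obtain ⟨y, hy, hxy⟩ := exists_parent hx
    obtain ⟨w, hw, hle⟩ := ih y hy
    exact ⟨_, depth_nodup_concat hx (unboxed_adj_of_reachable hy.1 hx.1 hxy.symm) hw hle⟩

/-- A geodesic from `u₁` through the levels, with a marked edge between two consecutive levels. -/
theorem exists_marked_simple_walk (hu : G.Adj u₀ u₁) {n : ℕ} (hn : i + 2 ≤ n) :
    ∀ x ∈ level G u₀ u₁ n, ∃ w : (unboxed G u₀ u₁).Walk u₁ x,
      (w.support.map (depth G u₀ u₁)).Nodup ∧ (∀ z ∈ w.support, depth G u₀ u₁ z ≤ n) ∧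
      ∃ t ∈ w.darts, t.fst ∈ level G u₀ u₁ (i + 1) ∧ t.snd ∈ region G u₀ u₁ (i + 2) x := by
  induction n, hn using Nat.le_induction with
  | base =>
    intro x hx
    obtain ⟨y, hy, hxy⟩ := exists_parent hx
    obtain ⟨w, hw, hle⟩ := exists_simple_walk hu i y hy
    have hyx := unboxed_adj_of_reachable hy.1 hx.1 hxy.symm
    obtain ⟨h1, h2⟩ := depth_nodup_concat hx hyx hw hle
    refine ⟨w.concat hyx, h1, h2, ⟨(y, x), hyx⟩, ?_, hy,
      mem_componentIn_self (level_subset_levelGE le_rfl hx)⟩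
    rw [SimpleGraph.Walk.darts_concat]
    simp
  | succ n hn ih =>
    intro x hx
    obtain ⟨y, hy, hxy⟩ := exists_parent hx
    obtain ⟨w, hw, hle, t, ht, ht1, ht2⟩ := ih y hy
    have hyx := unboxed_adj_of_reachable hy.1 hx.1 hxy.symm
    obtain ⟨h1, h2⟩ := depth_nodup_concat hx hyx hw hle
    refine ⟨w.concat hyx, h1, h2, t, ?_, ht1, componentIn_trans ?_ ht2⟩
    · rw [SimpleGraph.Walk.darts_concat]
      simp [ht]
    · exact region_step (mem_componentIn_self (level_subset_levelGE (by omega) hx))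
        (level_subset_levelGE (by omega) hy) hxy

end SimplePaths

/-! ### The invariant of the chase and the robber's possible escapes -/

section Chase

variable {V : Type*} {G : SimpleGraph V} {u₀ u₁ x y z p q r a b d m e v : V} {i j : ℕ}

/-- The chasing cops stand on king vertices of the level components in `L_j` that separate the
robber's region of `G₀[L_{≥ j + 1}]` from the lower levels. -/
structure Chase (G : SimpleGraph V) (u₀ u₁ : V) (j : ℕ) (a b r : V) : Prop where
  left : a ∈ level G u₀ u₁ j
  right : b ∈ level G u₀ u₁ j
  king_left : IsKing G (levelComponent G u₀ u₁ a) a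
  king_right : IsKing G (levelComponent G u₀ u₁ b) b
  robber : r ∈ levelGE G u₀ u₁ (j + 1)
  link : b ∈ region G u₀ u₁ j a
  attached : ∀ x ∈ level G u₀ u₁ j, Attached G u₀ u₁ (j + 1) r x →
    x ∈ levelComponent G u₀ u₁ a ∨ x ∈ levelComponent G u₀ u₁ b

theorem Chase.symm (h : Chase G u₀ u₁ j a b r) : Chase G u₀ u₁ j b a r :=
  ⟨h.right, h.left, h.king_right, h.king_left, h.robber, componentIn_symm h.link,
    fun x hx hr => (h.attached x hx hr).symm⟩

theorem Attached.congr (h : Attached G u₀ u₁ i r x) (hr : r ∈ region G u₀ u₁ i q) :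
    Attached G u₀ u₁ i q x := by
  obtain ⟨z, hz, hxz⟩ := h
  exact ⟨z, componentIn_trans hr hz, hxz⟩

/-- A simple path to the robber crosses from level `i + 1` into his region through an attached
vertex, and such vertices lie only in the components of the two cops. -/
theorem exists_isNextComponent (hu : G.Adj u₀ u₁) (h : Chase G u₀ u₁ (i + 1) a b r) :
    ∃ P, IsNextComponent G u₀ u₁ r (levelComponent G u₀ u₁ a) P ∨
      IsNextComponent G u₀ u₁ r (levelComponent G u₀ u₁ b) P := by
  obtain ⟨w, hw, -, t, ht, ht1, ht2⟩ := exists_marked_simple_walk hu h.robber.2 r ⟨h.robber.1, rfl⟩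
  refine ⟨levelComponent G u₀ u₁ t.snd, ?_⟩
  have hsimple : IsSimplePath G u₀ u₁ w :=
    ⟨SimpleGraph.Walk.IsPath.mk' hw.of_map, fun x hx y hy hxy =>
      List.inj_on_of_nodup_map hw hx hy hxy⟩
  exact (h.attached t.fst ht1 ⟨t.snd, ht2, t.adj.1⟩).imp
    (fun h => ⟨w, hsimple, t, ht, h, rfl⟩) fun h => ⟨w, hsimple, t, ht, h, rfl⟩

theorem exists_isMate (P : Set V) : ∃ M, IsMate G u₀ u₁ i P M := by
  by_cases h : ∃ E, IsLevelComponent G u₀ u₁ i E ∧ E ≠ P ∧ LinkedAbove G u₀ u₁ i P E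
  · obtain ⟨E, hE⟩ := h
    exact ⟨E, Or.inl hE⟩
  · push Not at h
    exact ⟨P, Or.inr ⟨rfl, h⟩⟩

/-- By `mateUnique` a component and its mate exhaust what is linked to it; if there is no other
linked component, `m = d` serves. -/
theorem IsMate.exists_vertex [Finite V] (hclaw : ClawFree G) (heven : EvenHoleFree G) {M : Set V}
    (hd : d ∈ level G u₀ u₁ i) (h : IsMate G u₀ u₁ i (levelComponent G u₀ u₁ d) M) :
    ∃ m ∈ level G u₀ u₁ i, M = levelComponent G u₀ u₁ m ∧ m ∈ region G u₀ u₁ i d ∧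
      ∀ e ∈ level G u₀ u₁ i, e ∈ region G u₀ u₁ i d →
        e ∈ levelComponent G u₀ u₁ d ∨ e ∈ levelComponent G u₀ u₁ m := by
  rcases h with ⟨⟨m, hm, rfl⟩, hne, x, hx, y, hy, hxy⟩ | ⟨rfl, hno⟩
  · have hmd : m ∈ region G u₀ u₁ i d :=
      componentIn_trans (componentIn_trans (levelComponent_subset_componentIn hd hx) hxy)
        (componentIn_symm (levelComponent_subset_componentIn hm hy))
    refine ⟨m, hm, rfl, hmd, fun e he hed => ?_⟩
    rcases mateUnique hclaw heven i d hd m hm e he hmd hed with h | h | h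
    exacts [absurd (levelComponent_eq hd h) hne, Or.inl h, Or.inr h]
  · refine ⟨d, hd, rfl, mem_componentIn_self (level_subset_levelGE le_rfl hd), fun e he hed => ?_⟩
    by_contra! hcon
    refine hno _ ⟨e, he, rfl⟩ (fun h => hcon.1 (h ▸ mem_levelComponent_self he)) ?_
    exact ⟨d, mem_levelComponent_self hd, e, mem_levelComponent_self he, hed⟩

/-- The vertices `d` and `m` represent the two components through which the robber's region
continues in the next level; the first is connected to the component of `a`. -/
structure Front (G : SimpleGraph V) (u₀ u₁ : V) (i : ℕ) (a r d m : V) : Prop where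
  left : d ∈ level G u₀ u₁ i
  right : m ∈ level G u₀ u₁ i
  mem : d ∈ region G u₀ u₁ i r
  link : m ∈ region G u₀ u₁ i d
  conn : ∃ x ∈ levelComponent G u₀ u₁ a, G.Adj x d
  cover : ∀ e ∈ level G u₀ u₁ i, e ∈ region G u₀ u₁ i r →
    e ∈ levelComponent G u₀ u₁ d ∨ e ∈ levelComponent G u₀ u₁ m

theorem exists_front [Finite V] (hclaw : ClawFree G) (heven : EvenHoleFree G) (hu : G.Adj u₀ u₁)
    {P M : Set V} (h : Chase G u₀ u₁ j a b r)
    (hP : IsNextComponent G u₀ u₁ r (levelComponent G u₀ u₁ a) P)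
    (hM : IsMate G u₀ u₁ (depth G u₀ u₁ a + 1) P M) :
    ∃ d m, P = levelComponent G u₀ u₁ d ∧ M = levelComponent G u₀ u₁ m ∧
      Front G u₀ u₁ (j + 1) a r d m := by
  obtain ⟨d, hd, hdr, rfl, hconn⟩ := hP.exists_vertex hu h.left h.robber
  rw [show depth G u₀ u₁ a = j from h.left.2] at hM
  obtain ⟨m, hm, rfl, hmd, hcov⟩ := hM.exists_vertex hclaw heven hd
  exact ⟨d, m, rfl, rfl, hd, hm, hdr, hmd, hconn, fun e he her =>
    hcov e he (componentIn_trans (componentIn_symm hdr) her)⟩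

/-- Each edge into the robber's region from below belongs to one cop. An edge joining the wrong pair
would give a component parents in two components, so this component would coincide with its mate and
the pairing still holds. -/
theorem Front.sides [Finite V] (hclaw : ClawFree G) (heven : EvenHoleFree G)
    (h : Chase G u₀ u₁ (i + 1) a b r) (hf : Front G u₀ u₁ (i + 2) a r d m)
    (hconn : ConnectedTo G (levelComponent G u₀ u₁ b) (levelComponent G u₀ u₁ m))
    (hx : x ∈ level G u₀ u₁ (i + 1)) (he : e ∈ region G u₀ u₁ (i + 2) r) (hxe : G.Adj x e) :
    (e ∈ levelComponent G u₀ u₁ d ∧ x ∈ levelComponent G u₀ u₁ a) ∨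
      (e ∈ levelComponent G u₀ u₁ m ∧ x ∈ levelComponent G u₀ u₁ b) := by
  have hel := mem_level_of_adj hx (componentIn_subset he) hxe
  obtain ⟨x', hx', hx'd⟩ := hf.conn
  obtain ⟨y', hy', m', hm', hy'm⟩ := hconn
  have hx'l := levelComponent_subset h.left hx'
  have hy'l := levelComponent_subset h.right hy'
  rcases hf.cover e hel he with hed | hem <;> rcases h.attached x hx ⟨e, he, hxe⟩ with hxa | hxb
  · exact Or.inl ⟨hed, hxa⟩
  · by_cases hxa : x ∈ levelComponent G u₀ u₁ a
    · exact Or.inl ⟨hed, hxa⟩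
    have := mem_levelComponent_of_two_parents hclaw heven hf.left hx'l hx
      (by rwa [levelComponent_eq h.left hx']) (mem_levelComponent_self hf.left) hed hx'd hxe
      hf.right hf.link
    rw [levelComponent_eq hf.left this]
    exact Or.inr ⟨hed, hxb⟩
  · by_cases hxb : x ∈ levelComponent G u₀ u₁ b
    · exact Or.inr ⟨hem, hxb⟩
    have := mem_levelComponent_of_two_parents hclaw heven hf.right hy'l hx
      (by rwa [levelComponent_eq h.right hy']) hm' hem hy'm hxe hf.left (componentIn_symm hf.link)
    rw [levelComponent_eq hf.right this]
    exact Or.inl ⟨hem, hxa⟩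
  · exact Or.inr ⟨hem, hxb⟩

/-- If the mate of the next component is not connected to the other cop's component, the robber's
region is attached to one component only. -/
theorem Front.attached_left [Finite V] (hclaw : ClawFree G) (heven : EvenHoleFree G)
    (h : Chase G u₀ u₁ (i + 1) a b r) (hf : Front G u₀ u₁ (i + 2) a r d m)
    (hconn : ¬ ConnectedTo G (levelComponent G u₀ u₁ b) (levelComponent G u₀ u₁ m))
    (hx : x ∈ level G u₀ u₁ (i + 1)) (hrx : Attached G u₀ u₁ (i + 2) r x) :
    x ∈ levelComponent G u₀ u₁ a := by
  by_contra hxa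
  have hxb := (h.attached x hx hrx).resolve_left hxa
  obtain ⟨e, he, hxe⟩ := hrx
  have hel := mem_level_of_adj hx (componentIn_subset he) hxe
  obtain ⟨x', hx', hx'd⟩ := hf.conn
  have hx'l := levelComponent_subset h.left hx'
  rcases hf.cover e hel he with hed | hem
  · have := mem_levelComponent_of_two_parents hclaw heven hf.left hx'l hx
      (by rwa [levelComponent_eq h.left hx']) (mem_levelComponent_self hf.left) hed hx'd hxe
      hf.right hf.link
    rw [levelComponent_eq hf.left this] at hconn
    exact hconn ⟨x, hxb, e, hed, hxe⟩
  · exact hconn ⟨x, hxb, e, hem, hxe⟩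

/-- Were both cops in one component, a parent of `m` would lie in it, contrary to incompleteness.
Synchronizing steps therefore occur only between different components. -/
theorem Front.right_notMem [Finite V] (hclaw : ClawFree G) (heven : EvenHoleFree G)
    (h : Chase G u₀ u₁ (i + 1) a b r) (hf : Front G u₀ u₁ (i + 2) a r d m)
    (hconn : ¬ ConnectedTo G (levelComponent G u₀ u₁ b) (levelComponent G u₀ u₁ m)) :
    b ∉ levelComponent G u₀ u₁ a := by
  intro hba
  obtain ⟨y, hy, hmy⟩ := exists_parent hf.right
  have := hf.attached_left hclaw heven h hconn hy
    ⟨m, componentIn_trans hf.mem hf.link, hmy.symm⟩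
  rw [← levelComponent_eq h.left hba] at this
  exact hconn ⟨y, this, m, mem_levelComponent_self hf.right, hmy.symm⟩

/-- A move keeps the robber in his region, brings him next to `c₀` on `u₀`, or drops him exactly one
level; only the last case needs the chasing cops. -/
theorem robber_move (hr : r ∈ levelGE G u₀ u₁ (i + 2)) (hmove : x = r ∨ G.Adj r x) :
    x ∈ region G u₀ u₁ (i + 2) r ∨ G.Adj u₀ x ∨
      (x ∈ level G u₀ u₁ (i + 1) ∧ r ∈ level G u₀ u₁ (i + 2) ∧ G.Adj x r) := by
  rcases hmove with rfl | hrx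
  · exact Or.inl (mem_componentIn_self hr)
  by_cases hbox : x ∈ box G u₀ u₁
  · exact Or.inr (Or.inl hbox.1)
  have hadj : (unboxed G u₀ u₁).Adj r x := ⟨hrx, notMem_box_of_reachable hr.1, hbox⟩
  have hx : (unboxed G u₀ u₁).Reachable u₀ x := hr.1.trans ⟨.cons hadj .nil⟩
  have h1 := depth_le_succ hx hadj.symm
  have h2 := hr.2
  rcases le_or_gt (i + 2) (depth G u₀ u₁ x) with h | h
  · exact Or.inl (region_step (mem_componentIn_self hr) ⟨hx, h⟩ hrx)
  · exact Or.inr (Or.inr ⟨⟨hx, by omega⟩, ⟨hr.1, by omega⟩, hrx.symm⟩)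

/-- Here `v` is where the cop was and `e` where he is now. Since `v` misses `r`, nestedness makes
every parent of `r` a parent of `e`, so a robber dropping from `r` is next to the cop. -/
theorem adj_king_of_adj (hclaw : ClawFree G) (heven : EvenHoleFree G)
    (hd : d ∈ level G u₀ u₁ (i + 2)) (hk : IsKing G (levelComponent G u₀ u₁ d) e)
    (hr : r ∈ levelComponent G u₀ u₁ d) (hv : v ∈ level G u₀ u₁ (i + 1)) (hve : G.Adj v e)
    (hvr : ¬ G.Adj v r) (hx : x ∈ level G u₀ u₁ (i + 1)) (hxr : G.Adj x r) : G.Adj e x := by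
  have hre : r ≠ e := by rintro rfl; exact hvr hve
  exact ((parents_nested hclaw heven (levelComponent_subset hd hk.1) (levelComponent_subset hd hr)
    (hk.2 r hr hre) hv hx hve hxr).resolve_left hvr).symm

theorem EvenHoleFree.adj_of_square (heven : EvenHoleFree G) {a b c d : V} (hab : G.Adj a b)
    (hbc : G.Adj b c) (hcd : G.Adj c d) (hda : G.Adj d a) (hac : a ≠ c) (hbd : b ≠ d) :
    G.Adj a c ∨ G.Adj b d := by
  by_contra! hcon
  have hpath : ∀ {x y : V}, G.Adj x y → IndPath G (fun k => if k = 0 then x else y) 1 := by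
    intro x y hxy s t hst ht
    obtain ⟨rfl, rfl⟩ : s = 0 ∧ t = 1 := by omega
    simpa using ⟨hxy.ne, hxy⟩
  refine absurd (heven.odd_of_indPaths (hpath hab) (hpath hcd.symm) le_rfl le_rfl ?_) (by decide)
  intro s hs t ht
  rcases (show s = 0 ∨ s = 1 by omega) with rfl | rfl <;>
    rcases (show t = 0 ∨ t = 1 by omega) with rfl | rfl
  · simpa using ⟨hda.ne', hda.symm⟩
  · simpa using ⟨hac, hcon.1⟩
  · simpa using ⟨hbd, hcon.2⟩
  · simpa using ⟨hbc.ne, hbc⟩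

/-- If `v` and `x` were distinct and nonadjacent, `a`, `v`, `x` and a common child of `v` and `x`
would span an induced square. The common child is `r` if `v` sees `r`, and otherwise the target `e`.
-/
theorem adj_waiting_of_adj (hclaw : ClawFree G) (heven : EvenHoleFree G)
    (ha : a ∈ level G u₀ u₁ (i + 1)) (hka : IsKing G (levelComponent G u₀ u₁ a) a)
    (hd : d ∈ level G u₀ u₁ (i + 2)) (hk : IsKing G (levelComponent G u₀ u₁ d) e)
    (hr : r ∈ levelComponent G u₀ u₁ d) (har : ¬ G.Adj a r) (hae : ¬ G.Adj a e)
    (hv : v ∈ levelComponent G u₀ u₁ a) (hve : G.Adj v e)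
    (hx : x ∈ levelComponent G u₀ u₁ a) (hxr : G.Adj x r) : v = x ∨ G.Adj v x := by
  by_contra! hcon
  have hva : v ≠ a := by rintro rfl; exact hae hve
  have hxa : x ≠ a := by rintro rfl; exact har hxr
  have hvl := levelComponent_subset ha hv
  have hxl := levelComponent_subset ha hx
  have hsq : ∀ {f}, f ∈ level G u₀ u₁ (i + 2) → ¬ G.Adj a f → G.Adj v f → ¬ G.Adj x f := by
    intro f hf haf hvf hxf
    rcases heven.adj_of_square (hka.2 v hv hva) hvf hxf.symm (hka.2 x hx hxa).symm
      (ne_of_level ha (level_subset_levelGE le_rfl hf) (by omega)) hcon.1 with h | h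
    exacts [haf h, hcon.2 h]
  have hrl := levelComponent_subset hd hr
  by_cases hvr : G.Adj v r
  · exact hsq hrl har hvr hxr
  · exact hsq (levelComponent_subset hd hk.1) hae hve
      (adj_king_of_adj hclaw heven hd hk hr hvl hve hvr hxl hxr).symm

end Chase

end CopsRobber

namespace CopsRobber

/-! ### Single turns and the symmetry between the chasing cops -/

section Turns

variable {V : Type*} {G : SimpleGraph V} {u₀ u₁ r a b : V} {t : ℕ} {s : AlgState V}

theorem algCaptures_of_caught (h : Caught s r) : AlgCaptures G u₀ t s r := by
  cases t
  exacts [h, Or.inl h]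

theorem copMove_update {k : ℕ} {c : Fin k → V} {i : Fin k} (h : G.Adj (c i) r) :
    CopMove G c (Function.update c i r) := by
  intro l
  by_cases hl : l = i
  · subst hl
    exact Or.inr (by simpa using h)
  · exact Or.inl (by simp [hl])

/-- All other kinds of turn require that no cop is adjacent to the robber, so the algorithm has to
capture. -/
theorem algCaptures_of_adj {i : Fin 3} (h : G.Adj (s.cop i) r) : AlgCaptures G u₀ (t + 1) s r := by
  refine Or.inr ⟨⟨_, .capture s r i h⟩, fun s' hs' => ?_⟩
  cases hs' with
  | capture _ _ l hl => exact ⟨copMove_update hl, Or.inl ⟨l, by simp⟩⟩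
  | setup _ _ hfree => exact absurd h (hfree i)
  | resume _ _ _ _ _ hfree => exact absurd h (hfree i)
  | stepFirst _ _ _ _ _ _ hfree => exact absurd h (hfree i)
  | stepSecond _ _ _ _ _ _ hfree => exact absurd h (hfree i)

theorem algCaptures_of_free (ht : t ≠ 0)
    (h : (∀ i, s.cop i ≠ r) → (∀ i, ¬ G.Adj (s.cop i) r) → AlgCaptures G u₀ t s r) :
    AlgCaptures G u₀ t s r := by
  by_cases h1 : ∃ i, s.cop i = r
  · exact algCaptures_of_caught h1
  by_cases h2 : ∃ i, G.Adj (s.cop i) r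
  · obtain ⟨i, hi⟩ := h2
    obtain ⟨t, rfl⟩ := Nat.exists_eq_succ_of_ne_zero ht
    exact algCaptures_of_adj hi
  · push Not at h1 h2
    exact h h1 h2

/-- The state in which `c₀` is on `u₀` and the chasing cops are at `a` and `b`. -/
abbrev chaseState (u₀ u₁ a b : V) (l : List (V × V)) : AlgState V :=
  ⟨![u₀, a, b], some u₁, l⟩

theorem copMove_chase {x y : V} (hx : x = a ∨ G.Adj a x) (hy : y = b ∨ G.Adj b y) :
    CopMove G ![u₀, a, b] ![u₀, x, y] := by
  intro i
  fin_cases i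
  exacts [Or.inl rfl, hx, hy]

theorem algCaptures_resume {x y : V} {l : List (V × V)} (hx : x = a ∨ G.Adj a x)
    (hy : y = b ∨ G.Adj b y)
    (h : (∀ i, ![u₀, a, b] i ≠ r) → (∀ i, ¬ G.Adj (![u₀, a, b] i) r) → x ≠ r → y ≠ r →
      ∀ r', (r' = r ∨ G.Adj r r') → AlgCaptures G u₀ t (chaseState u₀ u₁ x y l) r') :
    AlgCaptures G u₀ (t + 1) (chaseState u₀ u₁ a b ((x, y) :: l)) r := by
  refine algCaptures_of_free (by omega) fun hne hfree => ?_
  refine Or.inr ⟨⟨_, .resume _ u₁ r (x, y) l hfree⟩, fun s' hs' => ?_⟩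
  cases hs' with
  | capture _ _ i hi => exact absurd hi (hfree i)
  | resume =>
    refine ⟨copMove_chase hx hy, ?_⟩
    by_cases h1 : x = r
    · exact Or.inl ⟨1, h1⟩
    by_cases h2 : y = r
    · exact Or.inl ⟨2, h2⟩
    exact Or.inr (h hne hfree h1 h2)

/-- The state with the roles of the two chasing cops exchanged. -/
def AlgState.swap (s : AlgState V) : AlgState V :=
  ⟨s.cop ∘ Equiv.swap 1 2, s.gate, s.plan.map Prod.swap⟩

theorem AlgState.swap_swap (s : AlgState V) : s.swap.swap = s := by
  obtain ⟨c, g, l⟩ := s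
  simp only [AlgState.swap, List.map_map, Prod.swap_swap_eq, List.map_id, Function.comp_assoc]
  congr
  funext i
  simp

theorem comp_swap_vec (x y z : V) : ![x, y, z] ∘ Equiv.swap 1 2 = ![x, z, y] := by
  funext i
  fin_cases i <;> rfl

theorem AlgTurn.swap {s s' : AlgState V} (h : AlgTurn G u₀ s r s') :
    AlgTurn G u₀ s.swap r s'.swap := by
  have hfree' : ∀ {c : Fin 3 → V}, (∀ i, ¬ G.Adj (c i) r) →
      ∀ i, ¬ G.Adj ((c ∘ Equiv.swap 1 2) i) r := fun h i => h _
  cases h with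
  | capture _ _ i hi =>
    have := AlgTurn.capture (u₀ := u₀) s.swap r (Equiv.swap 1 2 i) (by simpa [AlgState.swap])
    have heq : (⟨Function.update s.cop i r, s.gate, s.plan⟩ : AlgState V).swap =
        ⟨Function.update s.swap.cop (Equiv.swap 1 2 i) r, s.swap.gate, s.swap.plan⟩ := by
      simp [AlgState.swap, Function.update_comp_equiv]
    rwa [heq]
  | setup c _ hfree p hp =>
    have := AlgTurn.setup (u₀ := u₀) (c ∘ Equiv.swap 1 2) r (hfree' hfree) p hp
    simpa only [AlgState.swap, comp_swap_vec, List.map_nil] using this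
  | resume c u₁ _ m l hfree =>
    have := AlgTurn.resume (u₀ := u₀) (c ∘ Equiv.swap 1 2) u₁ r m.swap (l.map Prod.swap)
      (hfree' hfree)
    simpa only [AlgState.swap, comp_swap_vec, List.map_cons, Prod.fst_swap, Prod.snd_swap] using this
  | stepFirst c u₁ _ a b l hfree hstep =>
    have := AlgTurn.stepSecond (u₀ := u₀) (c ∘ Equiv.swap 1 2) u₁ r b a l (hfree' hfree)
      (by simpa using hstep)
    simpa only [AlgState.swap, comp_swap_vec, List.map_nil] using this
  | stepSecond c u₁ _ a b l hfree hstep =>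
    have := AlgTurn.stepFirst (u₀ := u₀) (c ∘ Equiv.swap 1 2) u₁ r b a l (hfree' hfree)
      (by simpa using hstep)
    simpa only [AlgState.swap, comp_swap_vec, List.map_nil, List.map_map, Prod.swap_swap_eq,
      List.map_id] using this

theorem Caught.swap (h : Caught s r) : Caught s.swap r := by
  obtain ⟨i, hi⟩ := h
  exact ⟨Equiv.swap 1 2 i, by simpa [AlgState.swap] using hi⟩

/-- Steps led by `c₂` are thereby reduced to steps led by `c₁`. -/
theorem AlgCaptures.swap (h : AlgCaptures G u₀ t s r) : AlgCaptures G u₀ t s.swap r := by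
  induction t generalizing s r with
  | zero => exact Caught.swap h
  | succ t ih =>
    rcases h with h | ⟨⟨s', hs'⟩, h⟩
    · exact Or.inl h.swap
    · refine Or.inr ⟨⟨_, hs'.swap⟩, fun s'' hs'' => ?_⟩
      have h1 := hs''.swap
      rw [AlgState.swap_swap] at h1
      obtain ⟨hmove, h2⟩ := h _ h1
      refine ⟨fun i => by simpa [AlgState.swap] using hmove (Equiv.swap 1 2 i), ?_⟩
      refine h2.imp (fun h2 => ?_) fun h2 r' hr' => ?_
      · have := h2.swap
        rwa [AlgState.swap_swap] at this
      · have := ih (h2 r' hr')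
        rwa [AlgState.swap_swap] at this

end Turns

/-! ### Progressing steps and their cost -/

section Progress

variable {V : Type*} {G : SimpleGraph V} {u₀ u₁ x y z p q r a b d m e v w : V} {i j t : ℕ}

theorem ncard_add_one_le [Finite V] {S T : Set V} (h : S ⊆ T) (hx : x ∈ T) (hxS : x ∉ S) :
    S.ncard + 1 ≤ T.ncard := by
  rw [← Set.ncard_insert_of_notMem hxS]
  exact Set.ncard_le_ncard (Set.insert_subset hx h)

theorem ncard_add_two_le [Finite V] {S T : Set V} (h : S ⊆ T) (hx : x ∈ T) (hxS : x ∉ S)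
    (hy : y ∈ T) (hyS : y ∉ S) (hxy : x ≠ y) : S.ncard + 2 ≤ T.ncard := by
  have := ncard_add_one_le (Set.insert_subset hx h) hy
    (show y ∉ insert x S from fun h => h.elim (fun h => hxy h.symm) hyS)
  rwa [Set.ncard_insert_of_notMem hxS] at this

/-- The number of rounds that the chase may still take. -/
structure Budget (G : SimpleGraph V) (u₀ u₁ : V) (j : ℕ) (a b r : V) (t : ℕ) : Prop where
  region_le : (region G u₀ u₁ (j + 1) r).ncard ≤ t
  slack : (region G u₀ u₁ (j + 1) r).ncard + 1 ≤ t ∨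
    ∀ x ∈ level G u₀ u₁ j, Attached G u₀ u₁ (j + 1) r x → x = a ∧ x = b
  apart : b ∉ levelComponent G u₀ u₁ a → (region G u₀ u₁ j a).ncard ≤ t + 1

theorem Budget.symm (h : Budget G u₀ u₁ j a b r t) (hc : Chase G u₀ u₁ j a b r) :
    Budget G u₀ u₁ j b a r t := by
  refine ⟨h.region_le, h.slack.imp_right fun h x hx hr => (h x hx hr).symm, fun hab => ?_⟩
  rw [show region G u₀ u₁ j b = region G u₀ u₁ j a from componentIn_eq hc.link]
  exact h.apart fun hba => hab (mem_levelComponent_comm hc.left hba)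

theorem Chase.congr (h : Chase G u₀ u₁ j a b r) (hq : q ∈ region G u₀ u₁ (j + 1) r) :
    Chase G u₀ u₁ j a b q :=
  ⟨h.left, h.right, h.king_left, h.king_right, componentIn_subset hq, h.link,
    fun x hx hr => h.attached x hx (hr.congr hq)⟩

theorem Front.congr (h : Front G u₀ u₁ i a r d m) (hq : q ∈ region G u₀ u₁ i r) :
    Front G u₀ u₁ i a q d m :=
  ⟨h.left, h.right, componentIn_trans (componentIn_symm hq) h.mem, h.link, h.conn,
    fun e he heq => h.cover e he (componentIn_trans hq heq)⟩

variable (G u₀ u₁) in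
/-- The algorithm captures the robber within `t` rounds from every position of the chase within
its budget. -/
def ChaseWins (t : ℕ) : Prop :=
  ∀ j a b r, Chase G u₀ u₁ (j + 1) a b r → Budget G u₀ u₁ (j + 1) a b r t →
    AlgCaptures G u₀ t (chaseState u₀ u₁ a b []) r

/-- This covers the round in which both cops reach their kings `x` and `y`, having come from `v` and
`w`. The alternative `x = v` is a cop who arrived a round earlier. The robber is next to a cop
unless he has gone above level `i + 2`, and then the invariant holds one level higher. -/
theorem captures_of_arrive [Finite V] (hclaw : ClawFree G) (heven : EvenHoleFree G)
    (hwin : ChaseWins G u₀ u₁ t) (h : Chase G u₀ u₁ (i + 1) a b r)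
    (hf : Front G u₀ u₁ (i + 2) a r d m)
    (hconn : ConnectedTo G (levelComponent G u₀ u₁ b) (levelComponent G u₀ u₁ m))
    (hx : IsKing G (levelComponent G u₀ u₁ d) x) (hy : IsKing G (levelComponent G u₀ u₁ m) y)
    (hv : x = v ∨ (v ∈ level G u₀ u₁ (i + 1) ∧ G.Adj v x))
    (hw : y = w ∨ (w ∈ level G u₀ u₁ (i + 1) ∧ G.Adj w y))
    (hvr : ¬ G.Adj v r) (hwr : ¬ G.Adj w r) (hxr : x ≠ r) (hyr : y ≠ r)
    (ht : (region G u₀ u₁ (i + 2) r).ncard ≤ t + 1) (hmove : q = r ∨ G.Adj r q) :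
    AlgCaptures G u₀ t (chaseState u₀ u₁ x y []) q := by
  have hxl := levelComponent_subset hf.left hx.1
  have hyl := levelComponent_subset hf.right hy.1
  have hxc := levelComponent_eq hf.left hx.1
  have hyc := levelComponent_eq hf.right hy.1
  have hxR : x ∈ region G u₀ u₁ (i + 2) r :=
    componentIn_trans hf.mem (levelComponent_subset_componentIn hf.left hx.1)
  have hyR : y ∈ region G u₀ u₁ (i + 2) r := componentIn_trans hf.mem
    (componentIn_trans hf.link (levelComponent_subset_componentIn hf.right hy.1))
  have hrR : r ∈ region G u₀ u₁ (i + 2) r := mem_componentIn_self h.robber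
  have ht0 : t ≠ 0 := by
    rintro rfl
    have := ncard_add_two_le (Set.empty_subset _) hxR (Set.notMem_empty _) hrR
      (Set.notMem_empty _) hxr
    simp only [Set.ncard_empty] at this
    omega
  refine algCaptures_of_free ht0 fun hne hfree => ?_
  have hne1 : x ≠ q := hne 1
  have hne2 : y ≠ q := hne 2
  have hfree0 : ¬ G.Adj u₀ q := hfree 0
  have hfree1 : ¬ G.Adj x q := hfree 1
  have hfree2 : ¬ G.Adj y q := hfree 2
  rcases robber_move h.robber hmove with hq | hq | ⟨hq, hrl, hqr⟩
  · rcases mem_level_or_of_mem_levelGE (componentIn_subset hq) with hql | hql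
    · rcases hf.cover q hql hq with hqd | hqm
      exacts [absurd (hx.2 q hqd hne1.symm) hfree1, absurd (hy.2 q hqm hne2.symm) hfree2]
    · have hsub : region G u₀ u₁ (i + 1 + 1 + 1) q ⊆ region G u₀ u₁ (i + 2) r := fun z hz =>
        componentIn_trans hq (componentIn_mono (levelGE_anti (by omega)) hz)
      have hnot : ∀ {z}, z ∈ level G u₀ u₁ (i + 2) → z ∉ region G u₀ u₁ (i + 1 + 1 + 1) q :=
        fun hz hzq => notMem_levelGE_of_mem_level hz (by omega) (componentIn_subset hzq)
      have hattR : ∀ z ∈ level G u₀ u₁ (i + 2), Attached G u₀ u₁ (i + 1 + 1 + 1) q z →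
          z ∈ region G u₀ u₁ (i + 2) r := by
        rintro z hz ⟨e, he, hze⟩
        exact region_step (hsub he) (level_subset_levelGE le_rfl hz) hze.symm
      -- The landing place `x` leaves the region, which pays for this round.
      have hlt := ncard_add_one_le hsub hxR (hnot hxl)
      refine hwin (i + 1) x y q ⟨hxl, hyl, by rwa [hxc], by rwa [hyc], hql,
        componentIn_trans (componentIn_symm hxR) hyR, fun z hz hzq => ?_⟩ ⟨by omega, ?_, fun _ => ?_⟩
      · rw [hxc, hyc]
        exact hf.cover z hz (hattR z hz hzq)
      -- A door `z` into the new region differs from `x` or from `y` unless all three coincide.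
      -- Together with a landing place distinct from it, it makes a second lost vertex and hence a
      -- spare round.
      · by_contra! hcon
        obtain ⟨hcon, z, hz, hzq, hzxy⟩ := hcon
        have hzR := hattR z hz hzq
        by_cases hzx : z = x
        · have := ncard_add_two_le hsub hzR (hnot hz) hyR (hnot hyl) (hzxy hzx)
          omega
        · have := ncard_add_two_le hsub hzR (hnot hz) hxR (hnot hxl) hzx
          omega
      · rw [show region G u₀ u₁ (i + 1 + 1) x = region G u₀ u₁ (i + 2) r from componentIn_eq hxR]
        exact ht
  · exact absurd hq hfree0
  -- The robber dropped from `r`. A cop already waiting on a king would have been adjacent to `r`; a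
  -- cop who has just moved up is adjacent to `q`.
  · rcases hf.sides hclaw heven h hconn hq hrR hqr with ⟨hrd, -⟩ | ⟨hrm, -⟩
    · rcases hv with rfl | ⟨hvl, hvx⟩
      · exact absurd (hx.2 r hrd hxr.symm) hvr
      · exact absurd (adj_king_of_adj hclaw heven hf.left hx hrd hvl hvx hvr hq hqr) hfree1
    · rcases hw with rfl | ⟨hwl, hwy⟩
      · exact absurd (hy.2 r hrm hyr.symm) hwr
      · exact absurd (adj_king_of_adj hclaw heven hf.right hy hrm hwl hwy hwr hq hqr) hfree2

/-- A robber that leaves his region during the first round of a progressing step comes next to a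
cop. -/
theorem adj_of_route (hclaw : ClawFree G) (heven : EvenHoleFree G)
    (ha : a ∈ level G u₀ u₁ (i + 1)) (hka : IsKing G (levelComponent G u₀ u₁ a) a)
    (hd : d ∈ level G u₀ u₁ (i + 2)) (hx : IsKing G (levelComponent G u₀ u₁ d) x)
    (hr : r ∈ levelComponent G u₀ u₁ d) (har : ¬ G.Adj a r)
    (hv : IsRoute G (levelComponent G u₀ u₁ a) a x v)
    (hq : q ∈ levelComponent G u₀ u₁ a) (hqr : G.Adj q r) : v = q ∨ G.Adj v q := by
  rcases hv with ⟨hax, rfl⟩ | ⟨hax, hva, hvx⟩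
  · exact Or.inr (adj_king_of_adj hclaw heven hd hx hr ha hax har (levelComponent_subset ha hq) hqr)
  · exact adj_waiting_of_adj hclaw heven ha hka hd hx hr har hax hva hvx hq hqr

theorem IsRoute.move (hka : IsKing G (levelComponent G u₀ u₁ a) a)
    (hv : IsRoute G (levelComponent G u₀ u₁ a) a x v) : v = a ∨ G.Adj a v := by
  rcases hv with ⟨hax, rfl⟩ | ⟨hax, hva, hvx⟩
  · exact Or.inr hax
  · exact (eq_or_ne v a).imp_right (hka.2 v hva)

theorem IsRoute.arrive (ha : a ∈ level G u₀ u₁ j)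
    (hv : IsRoute G (levelComponent G u₀ u₁ a) a x v) :
    x = v ∨ (v ∈ level G u₀ u₁ j ∧ G.Adj v x) := by
  rcases hv with ⟨hax, rfl⟩ | ⟨hax, hva, hvx⟩
  exacts [Or.inl rfl, Or.inr ⟨levelComponent_subset ha hva, hvx⟩]

/-- A step of two rounds is paid for by the additional vertex that the delayed cop visits. -/
theorem Budget.of_delay (hb : Budget G u₀ u₁ j a b r t) (h : Chase G u₀ u₁ j a b r)
    (hx : x ∈ region G u₀ u₁ (j + 1) r) (hy : y ∈ region G u₀ u₁ (j + 1) r)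
    (hxy : ¬ (G.Adj a x ∧ G.Adj b y)) (hv : IsRoute G (levelComponent G u₀ u₁ a) a x v)
    (hw : IsRoute G (levelComponent G u₀ u₁ b) b y w) :
    (region G u₀ u₁ (j + 1) r).ncard + 1 ≤ t := by
  refine hb.slack.resolve_right fun hcon => hxy ⟨?_, ?_⟩
  · rcases hv with ⟨hax, -⟩ | ⟨-, hva, hvx⟩
    · exact hax
    · exact (hcon v (levelComponent_subset h.left hva) ⟨x, hx, hvx⟩).1 ▸ hvx
  · rcases hw with ⟨hby, -⟩ | ⟨-, hwb, hwy⟩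
    · exact hby
    · exact (hcon w (levelComponent_subset h.right hwb) ⟨y, hy, hwy⟩).2 ▸ hwy

/-- Between the two rounds of a delayed step the cops are at `v` and `w`. Dropping down now brings
the robber to a cop or next to one, so he remains in his region until the cops arrive. -/
theorem captures_of_depart [Finite V] (hclaw : ClawFree G) (heven : EvenHoleFree G)
    (hwin : ∀ t' < t, ChaseWins G u₀ u₁ t') (h : Chase G u₀ u₁ (i + 1) a b r)
    (hf : Front G u₀ u₁ (i + 2) a r d m)
    (hconn : ConnectedTo G (levelComponent G u₀ u₁ b) (levelComponent G u₀ u₁ m))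
    (hx : IsKing G (levelComponent G u₀ u₁ d) x) (hy : IsKing G (levelComponent G u₀ u₁ m) y)
    (hv : IsRoute G (levelComponent G u₀ u₁ a) a x v)
    (hw : IsRoute G (levelComponent G u₀ u₁ b) b y w)
    (har : ¬ G.Adj a r) (hbr : ¬ G.Adj b r)
    (ht : (region G u₀ u₁ (i + 2) r).ncard ≤ t) (hmove : q = r ∨ G.Adj r q) :
    AlgCaptures G u₀ t (chaseState u₀ u₁ v w [(x, y)]) q := by
  have hrR : r ∈ region G u₀ u₁ (i + 2) r := mem_componentIn_self h.robber
  have hpos : (region G u₀ u₁ (i + 2) r).ncard ≠ 0 := Set.ncard_ne_zero_of_mem hrR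
  obtain ⟨t, rfl⟩ := Nat.exists_eq_succ_of_ne_zero (show t ≠ 0 by omega)
  refine algCaptures_of_free (by omega) fun hne hfree => ?_
  have hne1 : v ≠ q := hne 1
  have hne2 : w ≠ q := hne 2
  have hfree1 : ¬ G.Adj v q := hfree 1
  have hfree2 : ¬ G.Adj w q := hfree 2
  rcases robber_move h.robber hmove with hq | hq | ⟨hq, hrl, hqr⟩
  · refine algCaptures_resume ((hv.arrive h.left).imp_right And.right)
      ((hw.arrive h.right).imp_right And.right) fun _ _ hxq hyq r' hr' => ?_
    refine captures_of_arrive hclaw heven (hwin t (by omega)) (h.congr hq) (hf.congr hq) hconn hx hy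
      (hv.arrive h.left) (hw.arrive h.right) hfree1 hfree2 hxq hyq ?_ hr'
    rwa [show region G u₀ u₁ (i + 2) q = region G u₀ u₁ (i + 2) r from componentIn_eq hq]
  · exact absurd hq (hfree 0)
  · rcases hf.sides hclaw heven h hconn hq hrR hqr with ⟨hrd, hqa⟩ | ⟨hrm, hqb⟩
    · exact absurd (adj_of_route hclaw heven h.left h.king_left hf.left hx hrd har hv hqa hqr)
        (not_or.2 ⟨hne1, hfree1⟩)
    · exact absurd (adj_of_route hclaw heven h.right h.king_right hf.right hy hrm hbr hw hqb hqr)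
        (not_or.2 ⟨hne2, hfree2⟩)

end Progress

end CopsRobber

namespace CopsRobber

/-! ### Synchronizing steps and their cost -/

section Synchronize

variable {V : Type*} {G : SimpleGraph V} {u₀ u₁ x y z q r a b d m e v w : V} {i j t : ℕ}

/-- A shortest path to a king vertex of the component of `a` avoids the robber's region. -/
theorem ncard_add_length_le [Finite V] (hclaw : ClawFree G) (h : Chase G u₀ u₁ (i + 1) a b r)
    (hf : Front G u₀ u₁ (i + 2) a r d m)
    (hatt : ∀ x ∈ level G u₀ u₁ (i + 1), Attached G u₀ u₁ (i + 2) r x →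
      x ∈ levelComponent G u₀ u₁ a)
    (hba : b ∉ levelComponent G u₀ u₁ a) (p : (unboxed G u₀ u₁).Walk b q)
    (hq : IsKing G (levelComponent G u₀ u₁ a) q)
    (hp : ∀ z ∈ p.support, z ∈ levelGE G u₀ u₁ (i + 1))
    (hshort : ∀ (q' : V) (p' : (unboxed G u₀ u₁).Walk b q'),
      IsKing G (levelComponent G u₀ u₁ a) q' →
      (∀ z ∈ p'.support, z ∈ levelGE G u₀ u₁ (i + 1)) → p.length ≤ p'.length) :
    (region G u₀ u₁ (i + 2) r).ncard + p.length + 1 ≤ (region G u₀ u₁ (i + 1) a).ncard ∧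
      ((region G u₀ u₁ (i + 2) r).ncard + p.length + 2 ≤ (region G u₀ u₁ (i + 1) a).ncard ∨
        ∀ x ∈ level G u₀ u₁ (i + 1), Attached G u₀ u₁ (i + 2) r x → x = a ∧ x = q) := by
  classical
  have hpath : p.IsPath := by
    rw [← p.bypass_eq_self_of_length_le_length_bypass
      (hshort q p.bypass hq fun z hz => hp z (p.support_bypass_subset_support hz))]
    exact p.bypass_isPath
  have htake : ∀ k, ∀ z ∈ (p.take k).support, z ∈ levelGE G u₀ u₁ (i + 1) := by
    intro k z hz
    rw [SimpleGraph.Walk.support_take] at hz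
    exact hp z (List.mem_of_mem_take hz)
  have hking : ∀ k ≤ p.length, IsKing G (levelComponent G u₀ u₁ a) (p.getVert k) →
      p.length ≤ k := by
    intro k hk hk'
    refine (hshort _ (p.take k) hk' (htake k)).trans ?_
    rw [SimpleGraph.Walk.take_length]
    exact min_le_left _ _
  -- Inside the component of `a` one further step to the king `a` would suffice, so a shortest path
  -- ends at most one step after entering it.
  have hlate : ∀ k ≤ p.length, p.getVert k ∈ levelComponent G u₀ u₁ a → p.length ≤ k + 1 := by
    intro k hk hka
    by_cases hkeq : p.getVert k = a
    · exact (hking k hk (hkeq ▸ h.king_left)).trans (Nat.le_succ k)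
    have hadj : (unboxed G u₀ u₁).Adj (p.getVert k) a :=
      unboxed_adj_of_reachable (levelComponent_subset h.left hka).1 h.left.1
        (h.king_left.2 _ hka hkeq).symm
    refine (hshort _ ((p.take k).concat hadj) h.king_left fun z hz => ?_).trans ?_
    · rw [SimpleGraph.Walk.support_concat, List.mem_append] at hz
      rcases hz with hz | hz
      · exact htake k z hz
      · rw [List.mem_singleton.1 hz]
        exact level_subset_levelGE le_rfl h.left
    · rw [SimpleGraph.Walk.length_concat, SimpleGraph.Walk.take_length]
      exact Nat.succ_le_succ (min_le_left _ _)
  have hnotR : ∀ {z}, z ∈ level G u₀ u₁ (i + 1) → z ∉ region G u₀ u₁ (i + 2) r :=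
    fun hz hzR => notMem_levelGE_of_mem_level hz (by omega) (componentIn_subset hzR)
  have hql := levelComponent_subset h.left hq.1
  -- The path starts outside the region and could enter it only from an attached vertex, which lies
  -- in the component of `a`. It would then end on that very step, but its end `q` is not in the
  -- region.
  have hdisj : ∀ k ≤ p.length, p.getVert k ∉ region G u₀ u₁ (i + 2) r := by
    intro k
    induction k with
    | zero =>
      intro _
      rw [p.getVert_zero]
      exact hnotR h.right
    | succ k ih =>
      intro hk hkR
      have hadj := p.adj_getVert_succ (show k < p.length by omega)
      rcases mem_level_or_of_mem_levelGE (hp _ (p.getVert_mem_support k)) with hl | hl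
      · have := hlate k (by omega) (hatt _ hl ⟨_, hkR, hadj.1⟩)
        rw [show k + 1 = p.length by omega, p.getVert_length] at hkR
        exact hnotR hql hkR
      · exact ih (by omega) (region_step hkR hl hadj.1.symm)
  have hK : region G u₀ u₁ (i + 2) r ∪ {z | z ∈ p.support} ⊆ region G u₀ u₁ (i + 1) a := by
    rintro z (hz | hz)
    · obtain ⟨x, hx, hxd⟩ := hf.conn
      have hdK := region_step (levelComponent_subset_componentIn h.left hx)
        (level_subset_levelGE (Nat.le_succ _) hf.left) hxd
      exact componentIn_trans hdK (componentIn_mono (levelGE_anti (Nat.le_succ _))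
        (componentIn_trans (componentIn_symm hf.mem) hz))
    · exact componentIn_trans h.link
        ⟨p.takeUntil z hz, fun v hv => hp v (p.support_takeUntil_subset_support hz hv)⟩
  have hcard : (region G u₀ u₁ (i + 2) r ∪ {z | z ∈ p.support}).ncard =
      (region G u₀ u₁ (i + 2) r).ncard + p.length + 1 := by
    rw [Set.ncard_union_eq]
    · have : {z | z ∈ p.support} = (p.support.toFinset : Set V) := by ext; simp
      rw [this, Set.ncard_coe_finset, List.toFinset_card_of_nodup hpath.support_nodup,
        SimpleGraph.Walk.length_support]
      rfl
    · rw [Set.disjoint_left]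
      intro z hzR hz
      obtain ⟨k, hk, hk'⟩ := SimpleGraph.Walk.mem_support_iff_exists_getVert.1 hz
      exact hdisj k hk' (hk ▸ hzR)
  refine ⟨hcard ▸ Set.ncard_le_ncard hK, ?_⟩
  by_contra! hcon
  obtain ⟨hlt, x, hx, hrx, hxne⟩ := hcon
  -- For the extra unit, a vertex of the large region outside both `R` and the path is needed: an
  -- attached `x` off the path, or else `a` itself.
  suffices hw : ∃ w ∈ region G u₀ u₁ (i + 1) a, w ∉ region G u₀ u₁ (i + 2) r ∧ w ∉ p.support by
    obtain ⟨w, hwK, hwR, hwp⟩ := hw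
    have := ncard_add_one_le hK hwK (fun h => h.elim hwR hwp)
    omega
  have hxa := hatt x hx hrx
  by_cases hxp : x ∈ p.support
  swap
  · exact ⟨x, levelComponent_subset_componentIn h.left hxa, hnotR hx, hxp⟩
  obtain ⟨k, rfl, hk⟩ := SimpleGraph.Walk.mem_support_iff_exists_getVert.1 hxp
  rcases k with _ | k
  · exact absurd (p.getVert_zero ▸ hxa) hba
  have hadj := p.adj_getVert_succ (show k < p.length by omega)
  -- The predecessor of `x` cannot lie above: as a child of `x` it would equal or be adjacent to the
  -- child `e` in the robber's region. So it is already in the component of `a`, and `x` must be the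
  -- last vertex `q`.
  have hka : p.getVert k ∈ levelComponent G u₀ u₁ a := by
    rcases mem_level_or_of_mem_levelGE (hp _ (p.getVert_mem_support k)) with hl | hl
    · exact mem_levelComponent_of_adj h.left hxa hl hadj.1.symm
    · obtain ⟨e, he, hxe⟩ := hrx
      refine absurd ?_ (hdisj k (by omega))
      by_cases hke : p.getVert k = e
      · exact hke ▸ he
      · exact region_step he hl (adj_of_common_parent hclaw hx
          (mem_level_of_adj hx hl hadj.1.symm) (mem_level_of_adj hx (componentIn_subset he) hxe)
          hadj.1.symm hxe hke).symm
  have hlen := hlate k (by omega) hka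
  have hxq : p.getVert (k + 1) = q := by
    rw [show k + 1 = p.length by omega, p.getVert_length]
  refine ⟨a, mem_componentIn_self (level_subset_levelGE le_rfl h.left), hnotR h.left, fun hap => ?_⟩
  obtain ⟨l, hl, hl'⟩ := SimpleGraph.Walk.mem_support_iff_exists_getVert.1 hap
  have hlen' := hking l hl' (hl ▸ h.king_left)
  rw [show l = p.length by omega, p.getVert_length] at hl
  exact hxne (hxq.trans hl) hxq

/-- While one cop walks, the king `a` alone guards the region, because every attached vertex lies in
the component of `a`. At the end both cops are in that component, so the chase resumes at the same
level and the condition `apart` is vacuous. -/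
theorem captures_of_synchronize [Finite V] (ha : a ∈ level G u₀ u₁ (i + 1))
    (hka : IsKing G (levelComponent G u₀ u₁ a) a) (hq : IsKing G (levelComponent G u₀ u₁ a) q)
    (p : (unboxed G u₀ u₁).Walk z q) :
    ∀ (t : ℕ) (r r' : V), (∀ t' ≤ t, ChaseWins G u₀ u₁ t') → r ∈ levelGE G u₀ u₁ (i + 2) →
      (∀ x ∈ level G u₀ u₁ (i + 1), Attached G u₀ u₁ (i + 2) r x →
        x ∈ levelComponent G u₀ u₁ a) →
      (region G u₀ u₁ (i + 2) r).ncard + p.length ≤ t →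
      ((region G u₀ u₁ (i + 2) r).ncard + p.length + 1 ≤ t ∨
        ∀ x ∈ level G u₀ u₁ (i + 1), Attached G u₀ u₁ (i + 2) r x → x = a ∧ x = q) →
      (r' = r ∨ G.Adj r r') →
      AlgCaptures G u₀ t (chaseState u₀ u₁ a z (p.support.tail.map fun z => (a, z))) r' := by
  induction p with
  | nil =>
    intro t r r' hwin hr hatt ht hs hmove
    have hpos : (region G u₀ u₁ (i + 2) r).ncard ≠ 0 :=
      Set.ncard_ne_zero_of_mem (mem_componentIn_self hr)
    refine algCaptures_of_free (by omega) fun hne hfree => ?_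
    rcases robber_move hr hmove with hr' | hr' | ⟨hr', -, hrr'⟩
    · have hreg : region G u₀ u₁ (i + 2) r' = region G u₀ u₁ (i + 2) r := componentIn_eq hr'
      refine hwin t le_rfl i a _ r' ⟨ha, levelComponent_subset ha hq.1, hka, ?_,
        componentIn_subset hr', levelComponent_subset_componentIn ha hq.1,
        fun x hx hrx => Or.inl (hatt x hx (hrx.congr hr'))⟩
        ⟨by rw [hreg]; exact ht, ?_, fun h => absurd hq.1 h⟩
      · rw [levelComponent_eq ha hq.1]
        exact hq
      · rw [hreg]
        exact hs.imp_right fun hs x hx hrx => hs x hx (hrx.congr hr')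
    · exact absurd hr' (hfree 0)
    · exact absurd (hka.2 r' (hatt r' hr' ⟨r, mem_componentIn_self hr, hrr'⟩) (hne 1).symm) (hfree 1)
  | cons hadj p ih =>
    intro t r r' hwin hr hatt ht hs hmove
    rw [SimpleGraph.Walk.length_cons] at ht hs
    obtain ⟨t, rfl⟩ := Nat.exists_eq_succ_of_ne_zero (show t ≠ 0 by omega)
    refine algCaptures_of_free (by omega) fun hne hfree => ?_
    rcases robber_move hr hmove with hr' | hr' | ⟨hr', -, hrr'⟩
    · have hreg : region G u₀ u₁ (i + 2) r' = region G u₀ u₁ (i + 2) r := componentIn_eq hr'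
      rw [SimpleGraph.Walk.support_cons, List.tail_cons, ← p.cons_tail_support, List.map_cons]
      refine algCaptures_resume (Or.inl rfl) (Or.inr hadj.1) fun _ _ _ _ r'' hr'' => ?_
      refine ih hq t r' r'' (fun t' ht' => hwin t' (by omega)) (componentIn_subset hr')
        (fun x hx hrx => hatt x hx (hrx.congr hr')) (by rw [hreg]; omega) ?_ hr''
      rw [hreg]
      exact hs.imp (fun hs => by omega) fun hs x hx hrx => hs x hx (hrx.congr hr')
    · exact absurd hr' (hfree 0)
    · exact absurd (hka.2 r' (hatt r' hr' ⟨r, mem_componentIn_self hr, hrr'⟩) (hne 1).symm) (hfree 1)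

end Synchronize

/-! ### Every step is available and leads to capture -/

section Steps

variable {V : Type*} {G : SimpleGraph V} {u₀ u₁ x y z q r a b d m e v w : V} {i j t : ℕ}

theorem captures_of_step [Finite V] (hclaw : ClawFree G) (heven : EvenHoleFree G)
    (hu : G.Adj u₀ u₁) (hwin : ∀ t' ≤ t, ChaseWins G u₀ u₁ t')
    (h : Chase G u₀ u₁ (i + 1) a b r) (hb : Budget G u₀ u₁ (i + 1) a b r (t + 1))
    (har : ¬ G.Adj a r) (hbr : ¬ G.Adj b r) {l : List (V × V)}
    (hstep : Step G u₀ u₁ r a b ((x, y) :: l)) :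
    (x = a ∨ G.Adj a x) ∧ (y = b ∨ G.Adj b y) ∧
      (x ≠ r → y ≠ r → ∀ r', (r' = r ∨ G.Adj r r') →
        AlgCaptures G u₀ t (chaseState u₀ u₁ x y l) r') := by
  generalize hl : (x, y) :: l = l' at hstep
  cases hstep with
  | progressOne P M a' b' hP hM hconn ha' hb' haa' hbb' =>
    obtain ⟨d, m, rfl, rfl, hf⟩ := exists_front hclaw heven hu h hP hM
    simp only [List.cons.injEq, Prod.mk.injEq] at hl
    obtain ⟨⟨rfl, rfl⟩, rfl⟩ := hl
    exact ⟨Or.inr haa', Or.inr hbb', fun hxr hyr r' hr' =>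
      captures_of_arrive hclaw heven (hwin t le_rfl) h hf hconn ha' hb' (Or.inr ⟨h.left, haa'⟩)
        (Or.inr ⟨h.right, hbb'⟩) har hbr hxr hyr hb.region_le hr'⟩
  | progressTwo P M a' b' v w hP hM hconn ha' hb' hab hv hw =>
    obtain ⟨d, m, rfl, rfl, hf⟩ := exists_front hclaw heven hu h hP hM
    simp only [List.cons.injEq, Prod.mk.injEq] at hl
    obtain ⟨⟨rfl, rfl⟩, rfl⟩ := hl
    have ha'R : a' ∈ region G u₀ u₁ (i + 2) r :=
      componentIn_trans hf.mem (levelComponent_subset_componentIn hf.left ha'.1)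
    have hb'R : b' ∈ region G u₀ u₁ (i + 2) r := componentIn_trans hf.mem
      (componentIn_trans hf.link (levelComponent_subset_componentIn hf.right hb'.1))
    have hdelay := hb.of_delay h ha'R hb'R hab hv hw
    exact ⟨hv.move h.king_left, hw.move h.king_right, fun _ _ r' hr' =>
      captures_of_depart hclaw heven (fun t' ht' => hwin t' ht'.le) h hf hconn ha' hb' hv hw har hbr
        (Nat.le_of_succ_le_succ hdelay) hr'⟩
  | synchronize P M q p hP hM hinc hq hp hshort =>
    obtain ⟨d, m, rfl, rfl, hf⟩ := exists_front hclaw heven hu h hP hM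
    rw [show depth G u₀ u₁ a = i + 1 from h.left.2] at hp hshort
    have hatt : ∀ x ∈ level G u₀ u₁ (i + 1), Attached G u₀ u₁ (i + 2) r x →
        x ∈ levelComponent G u₀ u₁ a := fun x hx => hf.attached_left hclaw heven h hinc hx
    have hba := hf.right_notMem hclaw heven h hinc
    -- Since one round of `t + 1` is being used, `apart` bounds the large region by `t + 2`; the
    -- vertices of the path then account for all rounds of the walk.
    obtain ⟨h1, h2⟩ := ncard_add_length_le hclaw h hf hatt hba p hq hp hshort
    have h3 := hb.apart hba
    cases p with
    | nil => simp at hl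
    | cons hadj p =>
      rw [SimpleGraph.Walk.support_cons, List.tail_cons, ← p.cons_tail_support, List.map_cons,
        List.cons.injEq, Prod.mk.injEq] at hl
      obtain ⟨⟨rfl, rfl⟩, rfl⟩ := hl
      rw [SimpleGraph.Walk.length_cons] at h1 h2
      refine ⟨Or.inl rfl, Or.inr hadj.1, fun _ _ r' hr' => ?_⟩
      exact captures_of_synchronize h.left h.king_left hq p t r r' hwin h.robber hatt (by omega)
        (h2.imp_left fun h2 => by omega) hr'

theorem exists_route {C : Set V} {k k' : V} (hx : x ∈ C) (hxk : G.Adj x k') :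
    ∃ v, IsRoute G C k k' v := by
  by_cases h : G.Adj k k'
  exacts [⟨k', Or.inl ⟨h, rfl⟩⟩, ⟨x, Or.inr ⟨h, hx, hxk⟩⟩]

/-- An arbitrary king need not be adjacent to a cop's component. Dominating kings are, so with them
routes exist and the algorithm is never stuck. -/
theorem exists_step [Finite V] (hclaw : ClawFree G) (heven : EvenHoleFree G)
    (hu : G.Adj u₀ u₁) (h : Chase G u₀ u₁ (i + 1) a b r) {P : Set V}
    (hP : IsNextComponent G u₀ u₁ r (levelComponent G u₀ u₁ a) P) :
    ∃ x y l, Step G u₀ u₁ r a b ((x, y) :: l) := by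
  obtain ⟨M, hM⟩ := exists_isMate (G := G) (u₀ := u₀) (u₁ := u₁) (i := depth G u₀ u₁ a + 1) P
  obtain ⟨d, m, hPd, hMm, hf⟩ := exists_front hclaw heven hu h hP hM
  by_cases hconn : ConnectedTo G (levelComponent G u₀ u₁ b) M
  · obtain ⟨a', ha', hdoma⟩ := exists_dominating_king hclaw heven hf.left
    obtain ⟨b', hb', hdomb⟩ := exists_dominating_king hclaw heven hf.right
    obtain ⟨x, hx, hxd⟩ := hf.conn
    obtain ⟨y, hy, m', hm', hym'⟩ := hconn
    rw [hMm] at hm'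
    have hxa' := hdoma d (mem_levelComponent_self hf.left) x (levelComponent_subset h.left hx) hxd
    have hyb' := hdomb m' hm' y (levelComponent_subset h.right hy) hym'
    rw [← hPd] at ha'
    rw [← hMm] at hb' hm'
    by_cases hab : G.Adj a a' ∧ G.Adj b b'
    · exact ⟨a', b', [], .progressOne P M a' b' hP hM ⟨y, hy, m', hm', hym'⟩ ha' hb' hab.1 hab.2⟩
    · obtain ⟨v, hv⟩ := exists_route (k := a) hx hxa'
      obtain ⟨w, hw⟩ := exists_route (k := b) hy hyb'
      exact ⟨v, w, _, .progressTwo P M a' b' v w hP hM ⟨y, hy, m', hm', hym'⟩ ha' hb' hab hv hw⟩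
  · have hba := hf.right_notMem hclaw heven h (hMm ▸ hconn)
    classical
    let Q : ℕ → Prop := fun n => ∃ (q : V) (p : (unboxed G u₀ u₁).Walk b q),
      IsKing G (levelComponent G u₀ u₁ a) q ∧ (∀ z ∈ p.support, z ∈ levelGE G u₀ u₁ (i + 1)) ∧
        p.length = n
    have hQ : ∃ n, Q n := by
      obtain ⟨w, hw⟩ := componentIn_symm h.link
      exact ⟨_, a, w, h.king_left, hw, rfl⟩
    obtain ⟨q, p, hq, hp, hlen⟩ := Nat.find_spec hQ
    have hstep := Step.synchronize (r := r) P M q p hP hM hconn hq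
      (by rwa [show depth G u₀ u₁ a = i + 1 from h.left.2]) (fun q' p' hq' hp' => by
        rw [show depth G u₀ u₁ a = i + 1 from h.left.2] at hp'
        rw [hlen]
        exact Nat.find_min' hQ ⟨q', p', hq', hp', rfl⟩)
    cases p with
    | nil => exact absurd hq.1 hba
    | cons hadj p =>
      rw [SimpleGraph.Walk.support_cons, List.tail_cons, ← p.cons_tail_support, List.map_cons] at hstep
      exact ⟨_, _, _, hstep⟩

/-- Strong induction on the remaining rounds is needed because a step may use several of them. -/
theorem chaseWins [Finite V] (hclaw : ClawFree G) (heven : EvenHoleFree G) (hu : G.Adj u₀ u₁)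
    (t : ℕ) : ChaseWins G u₀ u₁ t := by
  induction t using Nat.strong_induction_on with
  | _ t ih =>
    intro i a b r h hb
    have hpos : (region G u₀ u₁ (i + 2) r).ncard ≠ 0 :=
      Set.ncard_ne_zero_of_mem (mem_componentIn_self h.robber)
    have hle := hb.region_le
    obtain ⟨t, rfl⟩ := Nat.exists_eq_succ_of_ne_zero (show t ≠ 0 from fun h => by
      subst h
      exact hpos (Nat.le_zero.1 hle))
    refine algCaptures_of_free (by omega) fun hne hfree => Or.inr ⟨?_, fun s' hs' => ?_⟩
    · obtain ⟨P, hP | hP⟩ := exists_isNextComponent hu h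
      · obtain ⟨x, y, l, hstep⟩ := exists_step hclaw heven hu h hP
        exact ⟨_, .stepFirst _ u₁ r x y l hfree hstep⟩
      · obtain ⟨x, y, l, hstep⟩ := exists_step hclaw heven hu h.symm hP
        exact ⟨_, .stepSecond _ u₁ r y x l hfree hstep⟩
    · have hwin : ∀ t' ≤ t, ChaseWins G u₀ u₁ t' := fun t' ht' => ih t' (by omega)
      cases hs' with
      | capture _ _ k hk => exact absurd hk (hfree k)
      | stepFirst _ _ _ x y l _ hstep =>
        obtain ⟨h1, h2, h3⟩ := captures_of_step hclaw heven hu hwin h hb (hfree 1) (hfree 2) hstep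
        refine ⟨copMove_chase h1 h2, ?_⟩
        by_cases hx : x = r
        · exact Or.inl ⟨1, hx⟩
        by_cases hy : y = r
        · exact Or.inl ⟨2, hy⟩
        exact Or.inr (h3 hx hy)
      | stepSecond _ _ _ x y l _ hstep =>
        obtain ⟨h1, h2, h3⟩ := captures_of_step hclaw heven hu hwin h.symm (hb.symm h) (hfree 2)
          (hfree 1) hstep
        refine ⟨copMove_chase h2 h1, ?_⟩
        by_cases hx : x = r
        · exact Or.inl ⟨1, hx⟩
        by_cases hy : y = r
        · exact Or.inl ⟨2, hy⟩
        refine Or.inr fun r' hr' => ?_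
        have := (h3 hy hx r' hr').swap
        simpa only [AlgState.swap, comp_swap_vec] using this

end Steps

/-! ### The opening rounds and the resulting strategy -/

section Strategy

variable {V : Type*} {G : SimpleGraph V} {u₀ u₁ r : V}

/-- Along a shortest path from `u₀`, only the first vertex after `u₀` is a neighbour of `u₀`. -/
theorem mem_levelGE_two_of_shortest (p : G.Walk u₀ r) (hp : p.length = G.dist u₀ r)
    (hne : u₀ ≠ r) (hnadj : ¬ G.Adj u₀ r) : r ∈ levelGE G u₀ (p.getVert 1) 2 := by
  have hbox : ∀ k ≤ p.length, p.getVert k ∉ box G u₀ (p.getVert 1) := by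
    rintro k hk ⟨hadj, hk1⟩
    have hadj' : G.Adj u₀ (p.getVert k) := hadj
    have h1 : 1 < k := by
      rcases k with _ | _ | k
      · rw [p.getVert_zero] at hadj'
        exact absurd hadj' (G.irrefl)
      · exact absurd rfl hk1
      · omega
    have h2 := SimpleGraph.dist_le (.cons hadj' (p.drop k))
    rw [SimpleGraph.Walk.length_cons, SimpleGraph.Walk.drop_length] at h2
    omega
  have hreach : ∀ k ≤ p.length, (unboxed G u₀ (p.getVert 1)).Reachable u₀ (p.getVert k) := by
    intro k
    induction k with
    | zero => intro _; rw [p.getVert_zero]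
    | succ k ih =>
      intro hk
      exact (ih (by omega)).trans
        ⟨.cons ⟨p.adj_getVert_succ (by omega), hbox k (by omega), hbox _ hk⟩ .nil⟩
  have hr := hreach p.length le_rfl
  rw [p.getVert_length] at hr
  refine ⟨hr, ?_⟩
  by_contra hlt
  rcases (show depth G u₀ (p.getVert 1) r = 0 ∨ depth G u₀ (p.getVert 1) r = 1 by omega)
    with h | h
  · exact hne (eq_of_mem_level_zero ⟨hr, h⟩).symm
  · exact hnadj ((SimpleGraph.dist_eq_one_iff_adj.1 h).1)

theorem algCapturesWithin_card [Fintype V] (hconn : G.Connected) (hclaw : ClawFree G)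
    (heven : EvenHoleFree G) (u₀ : V) : AlgCapturesWithin G u₀ (Fintype.card V) := by
  obtain ⟨t, ht⟩ := Nat.exists_eq_succ_of_ne_zero (@Fintype.card_ne_zero V _ ⟨u₀⟩)
  rw [ht]
  intro r
  have huniv : (Set.univ : Set V).ncard = t + 1 := by
    rw [Set.ncard_univ, Nat.card_eq_fintype_card, ht]
  by_cases hur : u₀ = r
  · exact algCaptures_of_caught ⟨0, hur⟩
  have ht0 : t ≠ 0 := by
    rintro rfl
    have := ncard_add_two_le (Set.empty_subset _) (Set.mem_univ u₀) (Set.notMem_empty _)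
      (Set.mem_univ r) (Set.notMem_empty _) hur
    simp only [Set.ncard_empty] at this
    omega
  refine algCaptures_of_free ht0 fun _ hfree => ?_
  obtain ⟨t, rfl⟩ := Nat.exists_eq_succ_of_ne_zero ht0
  have hnadj : ¬ G.Adj u₀ r := hfree 0
  refine Or.inr ⟨?_, fun s' hs' => ?_⟩
  · obtain ⟨p, hp⟩ := hconn.exists_walk_length_eq_dist u₀ r
    exact ⟨_, .setup _ r hfree p hp⟩
  cases hs' with
  | capture _ _ k hk => exact absurd hk (hfree k)
  | setup _ _ _ p hp =>
    have hr := mem_levelGE_two_of_shortest p hp hur hnadj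
    have hu : G.Adj u₀ (p.getVert 1) := by
      have hlen : 0 < p.length := by
        rw [hp]
        exact hconn.pos_dist_of_ne hur
      simpa using p.adj_getVert_succ hlen
    refine ⟨fun i => ?_, Or.inr fun r' hr' => ?_⟩
    · fin_cases i
      exacts [Or.inl rfl, Or.inr hu, Or.inr hu]
    generalize p.getVert 1 = u₁ at *
    have hul := gate_mem_level hu
    -- Both `u₀` and `u₁` lie below level 2, so a region there has at most `n - 2` vertices, the
    -- number of rounds left after the opening.
    have hreg : ∀ q, (region G u₀ u₁ 2 q).ncard ≤ t := by
      intro q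
      have h0 : u₀ ∈ level G u₀ u₁ 0 := ⟨.refl _, SimpleGraph.dist_self⟩
      have := ncard_add_two_le (Set.subset_univ (region G u₀ u₁ 2 q)) (Set.mem_univ u₀)
        (fun h => notMem_levelGE_of_mem_level h0 (by omega) (componentIn_subset h))
        (Set.mem_univ u₁)
        (fun h => notMem_levelGE_of_mem_level hul (by omega) (componentIn_subset h)) hu.ne
      omega
    have hpos : (region G u₀ u₁ 2 r).ncard ≠ 0 :=
      Set.ncard_ne_zero_of_mem (mem_componentIn_self hr)
    have hregr := hreg r
    refine algCaptures_of_free (by omega) fun hne hfree' => ?_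
    rcases robber_move hr hr' with h | h | ⟨h, -, -⟩
    · have hking : IsKing G (levelComponent G u₀ u₁ u₁) u₁ :=
        ⟨mem_levelComponent_self hul, fun y hy hyu =>
          absurd (eq_of_mem_level_one (levelComponent_subset hul hy)) hyu⟩
      -- Both cops stand on `u₁`, the whole of level 1. The second alternative of `slack` holds, and
      -- no spare round is required.
      refine chaseWins hclaw heven hu t 0 u₁ u₁ r' ⟨hul, hul, hking, hking, componentIn_subset h,
        mem_componentIn_self (level_subset_levelGE le_rfl hul), fun x hx _ => ?_⟩
        ⟨hreg r', Or.inr fun x hx _ => ?_, fun hcon => absurd (mem_levelComponent_self hul) hcon⟩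
      · rw [eq_of_mem_level_one hx]
        exact Or.inl (mem_levelComponent_self hul)
      · exact ⟨eq_of_mem_level_one hx, eq_of_mem_level_one hx⟩
    · exact absurd h (hfree' 0)
    · exact absurd (eq_of_mem_level_one h).symm (hne 1)

open Classical in
/-- The states of a run of the algorithm, with arbitrary free choices; `h` lists the robber's
positions, the most recent one first. -/
noncomputable def runState (G : SimpleGraph V) (u₀ : V) : List V → AlgState V
  | [] => ⟨fun _ => u₀, none, []⟩
  | r :: h =>
    if hs : ∃ s', AlgTurn G u₀ (runState G u₀ h) r s' ∧ CopMove G (runState G u₀ h).cop s'.cop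
    then hs.choose else runState G u₀ h

/-- The algorithm as a strategy of three cops. -/
noncomputable def runStrategy (G : SimpleGraph V) (u₀ : V) : CopStrategy G 3 where
  position h := (runState G u₀ h).cop
  legal r h := by
    rw [runState]
    split_ifs with hs
    exacts [hs.choose_spec.2, fun _ => Or.inl rfl]

/-- `AlgCaptures` guarantees a legal turn as long as the robber is free, so the default of standing
still in `runState` is not used before the capture. -/
theorem runStrategy_captures {ρ : ℕ → V} (hρ : IsRobberPlay G ρ) (t : ℕ) :
    ∀ n, AlgCaptures G u₀ t (runState G u₀ (history ρ n)) (ρ n) →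
      ∃ k ≤ n + t, (runStrategy G u₀).CapturesAt ρ k := by
  induction t with
  | zero =>
    rintro n ⟨i, hi⟩
    exact ⟨n, le_rfl, i, Or.inr hi⟩
  | succ t ih =>
    rintro n (⟨i, hi⟩ | ⟨⟨s, hs⟩, h⟩)
    · exact ⟨n, by omega, i, Or.inr hi⟩
    have hex : ∃ s', AlgTurn G u₀ (runState G u₀ (history ρ n)) (ρ n) s' ∧
        CopMove G (runState G u₀ (history ρ n)).cop s'.cop := ⟨s, hs, (h s hs).1⟩
    have hrun : runState G u₀ (history ρ (n + 1)) = hex.choose := by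
      rw [history, runState, dif_pos hex]
    rcases (h _ hex.choose_spec.1).2 with ⟨i, hi⟩ | hcap
    · refine ⟨n + 1, by omega, i, Or.inl ⟨n, rfl, ?_⟩⟩
      rw [← hi, ← hrun]
      rfl
    · obtain ⟨k, hk, hk'⟩ := ih (n + 1) (hrun ▸ hcap _ (hρ n))
      exact ⟨k, by omega, hk'⟩

theorem AlgCapturesWithin.winsWithin {T : ℕ} (h : AlgCapturesWithin G u₀ T) :
    (runStrategy G u₀).WinsWithin T := by
  intro ρ hρ
  rcases T with _ | T
  · exact h.elim
  · obtain ⟨k, hk, hk'⟩ := runStrategy_captures hρ T 0 (h (ρ 0))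
    exact ⟨k, by omega, hk'⟩

end Strategy

end CopsRobber

theorem mainTheorem3 {V : Type*} [Fintype V] (G : SimpleGraph V) (hconn : G.Connected)
    (hclaw : CopsRobber.ClawFree G) (heven : CopsRobber.EvenHoleFree G) :
    (∀ u₀ : V, CopsRobber.AlgCapturesWithin G u₀ (Fintype.card V)) ∧
    (∀ u₀ : V, ∃ σ : CopsRobber.CopStrategy G 3,
      σ.position [] = (fun _ => u₀) ∧ σ.WinsWithin (Fintype.card V)) ∧
    CopsRobber.copNumber G ≤ 3 := by
  have hcap := CopsRobber.algCapturesWithin_card hconn hclaw heven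
  refine ⟨hcap, fun u₀ => ⟨CopsRobber.runStrategy G u₀, rfl, (hcap u₀).winsWithin⟩, ?_⟩
  obtain ⟨u₀⟩ := hconn.nonempty
  refine Nat.sInf_le ⟨CopsRobber.runStrategy G u₀, fun ρ hρ => ?_⟩
  obtain ⟨t, -, ht⟩ := (hcap u₀).winsWithin ρ hρ
  exact ⟨t, ht⟩
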